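/- A level graph $\mathcal G=(G=(V,E),\gamma)$ is a finite directed graph $G$ with a map $\gamma\colon V\to\mathbb R$ such that $\gamma(u)<\gamma(v)$ for every edge $(u,v)\in E$. A level planar drawing of $\mathcal G$ places the vertices at distinct points, each $v$ with y-coordinate $\gamma(v)$, and draws every edge as a y-monotone curve between its endpoints, such that no edge passes through another vertex and any two edges meet only in common endpoints. A visibility edge for a level planar drawing $\Gamma$ is (1) a y-monotone curve that joins two vertices, or (2) a horizontal segment that joins two consecutive vertices on a common level, which in either case can be inserted into $\Gamma$ without creating crossings (parallel edges are allowed). A visibility extension of $\Gamma$ with respect to $V'\subseteq V$ is a drawing $\Lambda$ obtained from $\Gamma$ by inserting an inclusion-maximal set of pairwise non-crossing visibility edges incident only to vertices of $V'$ such that for each pair $e,e'$ of parallel edges in $\Lambda$ at least one vertex of $V'$ lies in the interior of the simple closed curve formed by $e$ and $e'$. **Lemma.** There is an absolute constant $c$ such that the following holds. Let $\mathcal G=(G=(V,E),\gamma)$ be a level graph without isolated vertices, let $C$ be a vertex cover of (the underlying undirected graph of) $G$, let $\Gamma$ be a level planar drawing of $\mathcal G$, let $\Lambda$ be a visibility extension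 of $\Gamma$ with respect to $C$, and let $\Lambda_C$ be the subdrawing of $\Lambda$ induced by $C$ (the vertices of $C$ with all edges of $\Lambda$ that have both endpoints in $C$). Then $\Lambda_C$ is connected (provided $V\neq\emptyset$) and has at most $c\cdot k$ edges, where $k=|C|$ and parallel edges are counted separately; that is, $\Lambda_C$ has $\mathcal O(k)$ edges. -/

import Mathlib

namespace LevelPlanarity

/-- A level graph: a directed graph with a real level for each vertex that strictly increases
along every edge. -/
structure LevelGraph (V : Type*) where
  graph : Digraph V
  level : V → ℝ
  level_lt : ∀ u v, graph.Adj u v → level u < level v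

/-- The underlying undirected graph; vertex covers and isolated vertices refer to it. -/
def LevelGraph.undirected {V : Type*} (𝒢 : LevelGraph V) : SimpleGraph V :=
  𝒢.graph.toSimpleGraphInclusive

/-- `K` is (the set of points of) a y-monotone curve that starts in `p` and ends in `q`, which lies
above `p`: it is the graph of a continuous function that assigns to every y-coordinate between
those of `p` and `q` an x-coordinate. -/
def IsYMonotoneCurve (p q : ℝ × ℝ) (K : Set (ℝ × ℝ)) : Prop :=
  p.2 < q.2 ∧ ∃ f : ℝ → ℝ, ContinuousOn f (Set.Icc p.2 q.2) ∧ f p.2 = p.1 ∧ f q.2 = q.1 ∧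
    K = (fun y => (f y, y)) '' Set.Icc p.2 q.2

/-- The interior of a closed curve `K` in the plane: the points off `K` whose connected component
in the complement of `K` is bounded. -/
def curveInterior (K : Set (ℝ × ℝ)) : Set (ℝ × ℝ) :=
  {p | p ∉ K ∧ Bornology.IsBounded (connectedComponentIn Kᶜ p)}

/-- An edge of a drawing: its two endpoints and the curve that represents it. The `tail` is
the lower endpoint of a y-monotone edge, and the left endpoint of a horizontal edge. -/
structure DrawnEdge (V : Type*) where
  tail : V
  head : V
  curve : Set (ℝ × ℝ)

namespace DrawnEdge

variable {V : Type*}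

def ends (e : DrawnEdge V) : Set V := {e.tail, e.head}

/-- With the vertices placed by `pos`, the edges `e` and `f` meet in common endpoints only. -/
def NonCrossing (pos : V → ℝ × ℝ) (e f : DrawnEdge V) : Prop :=
  e.curve ∩ f.curve ⊆ pos '' (e.ends ∩ f.ends)

/-- The edge `e` passes through no vertex other than its endpoints. -/
def AvoidsVertices (pos : V → ℝ × ℝ) (e : DrawnEdge V) : Prop :=
  ∀ w, pos w ∈ e.curve → w ∈ e.ends

/-- Parallel edges: two different edges with the same endpoints. -/
def Parallel (e f : DrawnEdge V) : Prop := e ≠ f ∧ e.ends = f.ends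

end DrawnEdge

/-- A level planar drawing of a level graph: the vertices are distinct points on their levels, the
edges are upward y-monotone curves that pass through no further vertex and that meet only in common
endpoints. The value of `curve u v` is relevant only if `(u, v)` is an edge. -/
structure LevelPlanarDrawing {V : Type*} (𝒢 : LevelGraph V) where
  pos : V → ℝ × ℝ
  curve : V → V → Set (ℝ × ℝ)
  pos_injective : Function.Injective pos
  pos_level : ∀ v, (pos v).2 = 𝒢.level v
  curve_yMonotone : ∀ u v, 𝒢.graph.Adj u v → IsYMonotoneCurve (pos u) (pos v) (curve u v)
  curve_avoids : ∀ u v, 𝒢.graph.Adj u v → DrawnEdge.AvoidsVertices pos ⟨u, v, curve u v⟩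
  curve_nonCrossing : ∀ u v u' v', 𝒢.graph.Adj u v → 𝒢.graph.Adj u' v' → (u, v) ≠ (u', v') →
    DrawnEdge.NonCrossing pos ⟨u, v, curve u v⟩ ⟨u', v', curve u' v'⟩

namespace LevelPlanarDrawing

variable {V : Type*} {𝒢 : LevelGraph V}

/-- The edges of the drawing. -/
def edges (Γ : LevelPlanarDrawing 𝒢) : Set (DrawnEdge V) :=
  {e | 𝒢.graph.Adj e.tail e.head ∧ e.curve = Γ.curve e.tail e.head}

/-- `e` is a horizontal segment joining two consecutive vertices of a common level. -/
def IsLevelSegment (Γ : LevelPlanarDrawing 𝒢) (e : DrawnEdge V) : Prop :=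
  𝒢.level e.tail = 𝒢.level e.head ∧ (Γ.pos e.tail).1 < (Γ.pos e.head).1 ∧
    (∀ w, 𝒢.level w = 𝒢.level e.tail →
      ¬ ((Γ.pos e.tail).1 < (Γ.pos w).1 ∧ (Γ.pos w).1 < (Γ.pos e.head).1)) ∧
    e.curve = segment ℝ (Γ.pos e.tail) (Γ.pos e.head)

/-- A visibility edge: a y-monotone curve that joins two vertices, or a horizontal segment between
consecutive vertices of a level, that can be inserted into the drawing without crossings. -/
def IsVisibilityEdge (Γ : LevelPlanarDrawing 𝒢) (e : DrawnEdge V) : Prop :=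
  (IsYMonotoneCurve (Γ.pos e.tail) (Γ.pos e.head) e.curve ∨ Γ.IsLevelSegment e) ∧
    e.AvoidsVertices Γ.pos ∧ ∀ f ∈ Γ.edges, e.NonCrossing Γ.pos f

/-- `S` is a set of pairwise non-crossing visibility edges incident only to vertices of `C`, such
that after inserting `S` any two parallel edges enclose a vertex of `C`. -/
def IsVisibilitySet (Γ : LevelPlanarDrawing 𝒢) (C : Set V) (S : Set (DrawnEdge V)) : Prop :=
  (∀ e ∈ S, Γ.IsVisibilityEdge e ∧ e.tail ∈ C ∧ e.head ∈ C) ∧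
    (∀ e ∈ S, ∀ f ∈ S, e ≠ f → e.NonCrossing Γ.pos f) ∧
    (∀ e ∈ Γ.edges ∪ S, ∀ f ∈ Γ.edges ∪ S, e.Parallel f →
      ∃ w ∈ C, Γ.pos w ∈ curveInterior (e.curve ∪ f.curve))

end LevelPlanarDrawing

/-- A visibility extension of `Γ` with respect to `C`: the drawing obtained by inserting
an inclusion-maximal set of visibility edges as above. -/
structure VisibilityExtension {V : Type*} {𝒢 : LevelGraph V} (Γ : LevelPlanarDrawing 𝒢)
    (C : Set V) where
  added : Set (DrawnEdge V)
  maximal : Maximal (Γ.IsVisibilitySet C) added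

namespace VisibilityExtension

variable {V : Type*} {𝒢 : LevelGraph V} {Γ : LevelPlanarDrawing 𝒢} {C : Set V}

/-- All edges of the visibility extension. -/
def edges (Λ : VisibilityExtension Γ C) : Set (DrawnEdge V) := Γ.edges ∪ Λ.added

/-- The edges of the subdrawing induced by the vertex set `D`. -/
def inducedEdges (Λ : VisibilityExtension Γ C) (D : Set V) : Set (DrawnEdge V) :=
  {e ∈ Λ.edges | e.tail ∈ D ∧ e.head ∈ D}

/-- The adjacency graph of the subdrawing induced by the vertex set `D`. -/
def inducedGraph (Λ : VisibilityExtension Γ C) (D : Set V) : SimpleGraph D where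
  Adj u v := u ≠ v ∧ ∃ e ∈ Λ.inducedEdges D, e.ends = {u.1, v.1}
  symm := ⟨fun u v h => ⟨h.1.symm, by simpa only [Set.pair_comm] using h.2⟩⟩
  loopless := ⟨fun _ h => h.1 rfl⟩

end VisibilityExtension

end LevelPlanarity

/-! Edge bound. Level segments contribute at most k edges, since a segment is determined by its left
end. The y-monotone edges between vertices of C number at most 3k, by charging. An edge that is
rightmost among those leaving its lower end upwards is charged to that lower end. Any other edge `i`
has a right neighbour `j` with the same lower end; it is charged to a lowest vertex w of C in the
closed wedge between them. Such a w cannot lie on both edges: they would be parallel and enclose a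
lower vertex of C. So w is strictly left of `j` or strictly right of `i`, and each vertex receives
at most one charge of each of the three kinds.

Connectivity. Colour the vertices of C by their components in Λ_C; maximality gives equal colours to
any two vertices of C that see each other. Every point of the drawing inherits a colour, because it
lies on an edge with an end in C or is itself a vertex of C. The heart is `ColoredDrawing.upLine`:
on a horizontal line, consecutive points that lead upwards to C lead to the same colour. This goes
by induction from the top. If one of the two points is in C, there is a visibility curve or a level
segment; otherwise both edges are followed to the next level of vertices. Reflection gives the
downward version. A point leading only up and a neighbour leading only down are joined by a
visibility curve through the gap between them. Hence every line has a single colour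
(`eq_of_allC_line`), and neighbouring levels share one, by an edge spanning both or by a curve to
the right of everything (`exists_common_of_levels`). -/

namespace LevelPlanarity

/-! ### Monotone drawings and the left-to-right order of their edges -/

/-- A drawing whose edges are y-monotone curves, given as continuous functions of the height, that
pass through no further vertices and meet in vertices only. -/
structure MonotoneDrawing (V ι : Type*) where
  X : V → ℝ
  Y : V → ℝ
  bot : ι → V
  top : ι → V
  f : ι → ℝ → ℝ
  lt : ∀ i, Y (bot i) < Y (top i)
  cont : ∀ i, Continuous (f i)
  f_bot : ∀ i, f i (Y (bot i)) = X (bot i)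
  f_top : ∀ i, f i (Y (top i)) = X (top i)
  inj : ∀ u v, X u = X v → Y u = Y v → u = v
  avoid : ∀ i v, Y (bot i) ≤ Y v → Y v ≤ Y (top i) → f i (Y v) = X v → v = bot i ∨ v = top i
  cross : ∀ i j, i ≠ j → ∀ t, Y (bot i) ≤ t → t ≤ Y (top i) → Y (bot j) ≤ t → t ≤ Y (top j) →
    f i t = f j t → ∃ v, Y v = t ∧ X v = f i t

namespace MonotoneDrawing

variable {V ι : Type*} (D : MonotoneDrawing V ι)

/-- The edge `i` has a point at height `t`. -/
def On (i : ι) (t : ℝ) : Prop := D.Y (D.bot i) ≤ t ∧ t ≤ D.Y (D.top i)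

variable {D}

theorem bot_eq {i : ι} {v : V} (h : D.On i (D.Y v)) (hlt : D.Y v < D.Y (D.top i))
    (hf : D.f i (D.Y v) = D.X v) : D.bot i = v := by
  rcases D.avoid i v h.1 h.2 hf with h1 | h1
  · exact h1.symm
  · rw [h1] at hlt; exact absurd hlt (lt_irrefl _)

theorem top_eq {i : ι} {v : V} (h : D.On i (D.Y v)) (hlt : D.Y (D.bot i) < D.Y v)
    (hf : D.f i (D.Y v) = D.X v) : D.top i = v := by
  rcases D.avoid i v h.1 h.2 hf with h1 | h1
  · rw [h1] at hlt; exact absurd hlt (lt_irrefl _)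
  · exact h1.symm

theorem eq_of_interior {i j : ι} {t : ℝ} (h1 : D.Y (D.bot i) < t) (h2 : t < D.Y (D.top i))
    (hj : D.On j t) (h : D.f i t = D.f j t) : i = j := by
  by_contra hne
  obtain ⟨v, rfl, hv⟩ := D.cross i j hne t h1.le h2.le hj.1 hj.2 h
  rcases D.avoid i v h1.le h2.le hv.symm with h3 | h3
  · rw [← h3] at h1; exact lt_irrefl _ h1
  · rw [← h3] at h2; exact lt_irrefl _ h2

/-- Two edges keep their left-to-right order over their common range of heights. -/
theorem order {i j : ι} {s t : ℝ} (his : D.On i s) (hjs : D.On j s) (hit : D.On i t)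
    (hjt : D.On j t) (h : D.f i s < D.f j s) : D.f i t ≤ D.f j t := by
  by_contra hlt
  push Not at hlt
  have hc : ContinuousOn (fun r => D.f i r - D.f j r) (Set.uIcc s t) :=
    ((D.cont i).sub (D.cont j)).continuousOn
  have hz : (0 : ℝ) ∈ Set.uIcc (D.f i s - D.f j s) (D.f i t - D.f j t) :=
    Set.mem_uIcc.2 (Or.inl ⟨by linarith, by linarith⟩)
  obtain ⟨r, hr, h0⟩ := intermediate_value_uIcc hc hz
  have h0 : D.f i r = D.f j r := sub_eq_zero.1 h0
  have hrs : r ≠ s := by rintro rfl; exact h.ne h0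
  have hrt : r ≠ t := by rintro rfl; exact hlt.ne h0.symm
  -- The meeting height `r` is strictly between `s` and `t`, hence strictly inside `i`, where no
  -- other edge can meet it.
  have hb : D.Y (D.bot i) < r ∧ r < D.Y (D.top i) ∧ D.On j r := by
    rcases Set.mem_uIcc.1 hr with ⟨h1, h2⟩ | ⟨h1, h2⟩
    · have h1 := lt_of_le_of_ne h1 hrs.symm
      have h2 := lt_of_le_of_ne h2 hrt
      exact ⟨his.1.trans_lt h1, h2.trans_le hit.2, hjs.1.trans h1.le, h2.le.trans hjt.2⟩
    · have h1 := lt_of_le_of_ne h1 hrt.symm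
      have h2 := lt_of_le_of_ne h2 hrs
      exact ⟨hit.1.trans_lt h1, h2.trans_le his.2, hjt.1.trans h1.le, h2.le.trans hjs.2⟩
  have := eq_of_interior hb.1 hb.2.1 hb.2.2 h0
  subst this
  exact lt_irrefl _ h

theorem order_lt {i j : ι} {s t : ℝ} (his : D.On i s) (hjs : D.On j s)
    (hi1 : D.Y (D.bot i) < t) (hi2 : t < D.Y (D.top i))
    (hjt : D.On j t) (h : D.f i s < D.f j s) : D.f i t < D.f j t := by
  refine lt_of_le_of_ne (order his hjs ⟨hi1.le, hi2.le⟩ hjt h) fun he => ?_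
  have := eq_of_interior hi1 hi2 hjt he
  subst this
  exact lt_irrefl _ h

/-- There is a height just above `t`, below all vertices that lie above `t`. -/
theorem exists_height_above [Finite V] (Y : V → ℝ) (t : ℝ) :
    ∃ s, t < s ∧ ∀ v, t < Y v → s < Y v := by
  have h : ∀ᶠ s in nhdsWithin t (Set.Ioi t), ∀ v, t < Y v → s < Y v := by
    refine Filter.eventually_all.2 fun v => ?_
    by_cases hv : t < Y v
    · filter_upwards [Ioo_mem_nhdsGT hv] with s hs _ using hs.2
    · exact Filter.Eventually.of_forall fun s h => absurd h hv
  obtain ⟨s, hs, h1⟩ := (h.and self_mem_nhdsWithin).exists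
  exact ⟨s, h1, hs⟩

/-! ### Charging monotone edges to vertices -/

section Counting

/-- `j` is the next edge to the right of `i` among the edges that leave the same vertex upwards;
the edges that leave `u` are compared at the height `τ u`. -/
def Next (D : MonotoneDrawing V ι) (τ : V → ℝ) (i j : ι) : Prop :=
  D.bot j = D.bot i ∧ D.f i (τ (D.bot i)) < D.f j (τ (D.bot i)) ∧
    ∀ k, D.bot k = D.bot i → D.f i (τ (D.bot i)) < D.f k (τ (D.bot i)) →
      D.f j (τ (D.bot i)) ≤ D.f k (τ (D.bot i))

/-- `w` lies in the closed region between `i` and `j`. -/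
def InWedge (D : MonotoneDrawing V ι) (i j : ι) (w : V) : Prop :=
  D.Y (D.bot i) < D.Y w ∧ D.Y w ≤ D.Y (D.top i) ∧ D.Y w ≤ D.Y (D.top j) ∧
    D.f i (D.Y w) ≤ D.X w ∧ D.X w ≤ D.f j (D.Y w)

/-- `w` is a lowest vertex of `S` in the closed region between `i` and `j`. -/
def FirstInWedge (D : MonotoneDrawing V ι) (S : Set V) (i j : ι) (w : V) : Prop :=
  w ∈ S ∧ D.InWedge i j w ∧ ∀ z ∈ S, D.InWedge i j z → D.Y w ≤ D.Y z

variable {S : Set V} {τ : V → ℝ}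

/-- If `k` started above `bot i`, its lower end would be a vertex of `S` in the wedge below `w`.
Otherwise `k` is squeezed through the apex `bot i`, so it starts there and separates `i` from its
right neighbour `j`. -/
theorem not_between (hS : ∀ i, D.bot i ∈ S ∧ D.top i ∈ S)
    (hτ : ∀ u, D.Y u < τ u ∧ ∀ v, D.Y u < D.Y v → τ u < D.Y v) {i j k : ι} {w : V} {t : ℝ}
    (hn : D.Next τ i j) (hw : D.FirstInWedge S i j w) (h1 : D.Y (D.bot i) < t) (h2 : t < D.Y w)
    (hk1 : D.Y (D.bot k) < t) (hk2 : t < D.Y (D.top k))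
    (hik : D.f i t < D.f k t) (hkj : D.f k t < D.f j t) : False := by
  obtain ⟨hwS, ⟨hw1, hw2, hw3, -, -⟩, hmin⟩ := hw
  have hbj : D.Y (D.bot j) = D.Y (D.bot i) := by rw [hn.1]
  have hit : D.On i t := ⟨h1.le, (h2.trans_le hw2).le⟩
  have hjt : D.On j t := ⟨hbj.trans_le h1.le, (h2.trans_le hw3).le⟩
  have hkt : D.On k t := ⟨hk1.le, hk2.le⟩
  rcases lt_or_ge (D.Y (D.bot i)) (D.Y (D.bot k)) with hlt | hle
  · have hk : D.On k (D.Y (D.bot k)) := ⟨le_rfl, (D.lt k).le⟩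
    have hi : D.On i (D.Y (D.bot k)) := ⟨hlt.le, hk1.le.trans hit.2⟩
    have hj : D.On j (D.Y (D.bot k)) := ⟨hbj.trans_le hlt.le, hk1.le.trans hjt.2⟩
    have := hmin (D.bot k) (hS k).1 ⟨hlt, hi.2, hj.2, by
      rw [← D.f_bot]; exact order hit hkt hi hk hik, by
      rw [← D.f_bot]; exact order hkt hjt hk hj hkj⟩
    linarith
  · have hi : D.On i (D.Y (D.bot i)) := ⟨le_rfl, (D.lt i).le⟩
    have hj : D.On j (D.Y (D.bot i)) := ⟨hbj.le, h1.le.trans hjt.2⟩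
    have hk : D.On k (D.Y (D.bot i)) := ⟨hle, (h1.trans hk2).le⟩
    have e1 := order hit hkt hi hk hik
    have e2 := order hkt hjt hk hj hkj
    rw [D.f_bot] at e1
    have e3 : D.f j (D.Y (D.bot i)) = D.X (D.bot i) := by rw [← hn.1, D.f_bot]
    have hbk : D.bot k = D.bot i := bot_eq hk (h1.trans hk2) (by linarith)
    have hτi := hτ (D.bot i)
    have key : ∀ l, D.bot l = D.bot i → D.Y (D.bot l) < τ (D.bot i) ∧ τ (D.bot i) < D.Y (D.top l) :=
      fun l hl => ⟨by rw [hl]; exact hτi.1, hτi.2 _ (by rw [← hl]; exact D.lt l)⟩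
    have on : ∀ l, D.bot l = D.bot i → D.On l (τ (D.bot i)) :=
      fun l hl => ⟨(key l hl).1.le, (key l hl).2.le⟩
    have f1 := order_lt hit hkt (key i rfl).1 (key i rfl).2 (on k hbk) hik
    have f2 := order_lt hkt hjt (key k hbk).1 (key k hbk).2 (on j hn.1) hkj
    exact absurd (hn.2.2 k hbk f1) (not_le.2 f2)

/-- Just below `w`, the further right of two distinct left boundaries would run strictly between the
other one and its right neighbour, because `w` is strictly left of both right boundaries. -/
theorem eq_of_first_left (hS : ∀ i, D.bot i ∈ S ∧ D.top i ∈ S)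
    (hτ : ∀ u, D.Y u < τ u ∧ ∀ v, D.Y u < D.Y v → τ u < D.Y v) {i j i' j' : ι} {w : V}
    (hn : D.Next τ i j) (hw : D.FirstInWedge S i j w) (hx : D.X w < D.f j (D.Y w))
    (hn' : D.Next τ i' j') (hw' : D.FirstInWedge S i' j' w) (hx' : D.X w < D.f j' (D.Y w)) :
    i = i' := by
  obtain ⟨t, ht, htw⟩ := exists_between (max_lt hw.2.1.1 hw'.2.1.1)
  have ht1 := (le_max_left _ _).trans_lt ht
  have ht2 := (le_max_right _ _).trans_lt ht
  have aux : ∀ {i j i' j'}, D.Next τ i j → D.FirstInWedge S i j w → D.X w < D.f j (D.Y w) →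
      D.Next τ i' j' → D.FirstInWedge S i' j' w → D.Y (D.bot i) < t → D.Y (D.bot i') < t →
      D.f i t < D.f i' t → False := by
    intro i j i' j' hn hw hx hn' hw' ht1 ht2 hlt
    obtain ⟨-, ⟨a1, a2, a3, a4, a5⟩, -⟩ := id hw
    obtain ⟨-, ⟨b1, b2, b3, b4, b5⟩, -⟩ := id hw'
    have hbj : D.Y (D.bot j) = D.Y (D.bot i) := by rw [hn.1]
    refine not_between hS hτ hn hw ht1 htw ht2 (htw.trans_le b2) hlt ?_
    exact order_lt (s := D.Y w) ⟨b1.le, b2⟩ ⟨by linarith, a3⟩ ht2 (htw.trans_le b2)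
      ⟨by linarith, by linarith⟩ (by linarith)
  rcases lt_trichotomy (D.f i t) (D.f i' t) with h | h | h
  · exact (aux hn hw hx hn' hw' ht1 ht2 h).elim
  · exact eq_of_interior ht1 (htw.trans_le hw.2.1.2.1) ⟨ht2.le, htw.le.trans hw'.2.1.2.1⟩ h
  · exact (aux hn' hw' hx' hn hw ht2 ht1 h).elim

/-- The mirrored argument identifies the right boundaries; `i` and `i'` are then both the immediate
left neighbour of the same edge. Reflection is not directly available since `Next` is not symmetric.
-/
theorem eq_of_first_right (hS : ∀ i, D.bot i ∈ S ∧ D.top i ∈ S)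
    (hτ : ∀ u, D.Y u < τ u ∧ ∀ v, D.Y u < D.Y v → τ u < D.Y v) {i j i' j' : ι} {w : V}
    (hn : D.Next τ i j) (hw : D.FirstInWedge S i j w) (hx : D.f i (D.Y w) < D.X w)
    (hn' : D.Next τ i' j') (hw' : D.FirstInWedge S i' j' w) (hx' : D.f i' (D.Y w) < D.X w) :
    i = i' := by
  obtain ⟨t, ht, htw⟩ := exists_between (max_lt hw.2.1.1 hw'.2.1.1)
  have ht1 := (le_max_left _ _).trans_lt ht
  have ht2 := (le_max_right _ _).trans_lt ht
  have aux : ∀ {i j i' j'}, D.Next τ i j → D.FirstInWedge S i j w → D.f i (D.Y w) < D.X w →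
      D.Next τ i' j' → D.FirstInWedge S i' j' w → D.Y (D.bot i) < t → D.Y (D.bot i') < t →
      D.f j' t < D.f j t → False := by
    intro i j i' j' hn hw hx hn' hw' ht1 ht2 hlt
    obtain ⟨-, ⟨a1, a2, a3, a4, a5⟩, -⟩ := id hw
    obtain ⟨-, ⟨b1, b2, b3, b4, b5⟩, -⟩ := id hw'
    have hbj : D.Y (D.bot j') = D.Y (D.bot i') := by rw [hn'.1]
    refine not_between hS hτ hn hw ht1 htw (hbj.trans_lt ht2) (htw.trans_le b3) ?_ hlt
    exact order_lt (s := D.Y w) ⟨a1.le, a2⟩ ⟨by linarith, b3⟩ ht1 (htw.trans_le a2)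
      ⟨by linarith, by linarith⟩ (by linarith)
  have hbj : D.Y (D.bot j) = D.Y (D.bot i) := by rw [hn.1]
  have hbj' : D.Y (D.bot j') = D.Y (D.bot i') := by rw [hn'.1]
  rcases lt_trichotomy (D.f j t) (D.f j' t) with h | h | h
  · exact (aux hn' hw' hx' hn hw ht2 ht1 h).elim
  · have hj : j = j' := eq_of_interior (hbj.trans_lt ht1) (htw.trans_le hw.2.1.2.2.1)
      ⟨hbj'.trans_le ht2.le, htw.le.trans hw'.2.1.2.2.1⟩ h
    subst hj
    have hb : D.bot i' = D.bot i := by rw [← hn.1, ← hn'.1]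
    have hτi := hτ (D.bot i)
    have key : ∀ l, D.bot l = D.bot i → D.Y (D.bot l) < τ (D.bot i) ∧ τ (D.bot i) < D.Y (D.top l) :=
      fun l hl => ⟨by rw [hl]; exact hτi.1, hτi.2 _ (by rw [← hl]; exact D.lt l)⟩
    rcases lt_trichotomy (D.f i (τ (D.bot i))) (D.f i' (τ (D.bot i))) with h' | h' | h'
    · have := hn.2.2 i' hb h'
      have h3 := hn'.2.1
      rw [hb] at h3
      linarith
    · exact eq_of_interior (key i rfl).1 (key i rfl).2 ⟨(key i' hb).1.le, (key i' hb).2.le⟩ h'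
    · have := hn'.2.2 i hb.symm (by rw [hb]; exact h')
      have h3 := hn.2.1
      rw [hb] at this
      linarith
  · exact (aux hn hw hx hn' hw' ht1 ht2 h).elim

theorem exists_charge [Finite V] [Finite ι] (hS : ∀ i, D.bot i ∈ S ∧ D.top i ∈ S)
    (hτ : ∀ u, D.Y u < τ u ∧ ∀ v, D.Y u < D.Y v → τ u < D.Y v)
    (par : ∀ i j, i ≠ j → D.bot i = D.bot j → D.top i = D.top j → ∃ w ∈ S,
      D.Y (D.bot i) < D.Y w ∧ D.Y w < D.Y (D.top i) ∧
      (D.f i (D.Y w) < D.X w ∧ D.X w < D.f j (D.Y w) ∨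
        D.f j (D.Y w) < D.X w ∧ D.X w < D.f i (D.Y w))) (i : ι) :
    (∀ j, D.bot j = D.bot i → D.f j (τ (D.bot i)) ≤ D.f i (τ (D.bot i))) ∨
      ∃ j w, D.Next τ i j ∧ D.FirstInWedge S i j w ∧
        (D.X w < D.f j (D.Y w) ∨ D.f i (D.Y w) < D.X w) := by
  by_cases hr : ∀ j, D.bot j = D.bot i → D.f j (τ (D.bot i)) ≤ D.f i (τ (D.bot i))
  · exact Or.inl hr
  right
  push Not at hr
  obtain ⟨j, ⟨hj1, hj2⟩, hj3⟩ := Set.exists_min_image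
    {j | D.bot j = D.bot i ∧ D.f i (τ (D.bot i)) < D.f j (τ (D.bot i))}
    (fun j => D.f j (τ (D.bot i))) (Set.toFinite _) hr
  have hn : D.Next τ i j := ⟨hj1, hj2, fun k h1 h2 => hj3 k ⟨h1, h2⟩⟩
  have hbj : D.Y (D.bot j) = D.Y (D.bot i) := by rw [hj1]
  have hτi := hτ (D.bot i)
  have hoi : D.On i (τ (D.bot i)) := ⟨hτi.1.le, (hτi.2 _ (D.lt i)).le⟩
  have hoj : D.On j (τ (D.bot i)) := ⟨hbj.trans_le hτi.1.le, (hτi.2 _ (hbj ▸ D.lt j)).le⟩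
  -- The lower of the two upper ends lies in the closed wedge.
  have hne : {w | w ∈ S ∧ D.InWedge i j w}.Nonempty := by
    rcases le_total (D.Y (D.top i)) (D.Y (D.top j)) with h | h
    · refine ⟨D.top i, (hS i).2, D.lt i, le_rfl, h, (D.f_top i).le, ?_⟩
      rw [← D.f_top i]
      exact order hoi hoj ⟨(D.lt i).le, le_rfl⟩ ⟨hbj.trans_le (D.lt i).le, h⟩ hj2
    · refine ⟨D.top j, (hS j).2, hbj ▸ D.lt j, h, le_rfl, ?_, (D.f_top j).ge⟩
      rw [← D.f_top j]
      exact order hoi hoj ⟨hbj ▸ (D.lt j).le, h⟩ ⟨(D.lt j).le, le_rfl⟩ hj2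
  obtain ⟨w, ⟨hwS, hw⟩, hmin⟩ := Set.exists_min_image _ D.Y (Set.toFinite _) hne
  refine ⟨j, w, hn, ⟨hwS, hw, fun z h1 h2 => hmin z ⟨h1, h2⟩⟩, ?_⟩
  -- Otherwise `w` lies on both boundaries, so both edges end in `w`, and the vertex enclosed by
  -- these parallel edges is lower than `w`.
  by_contra hcon
  push Not at hcon
  obtain ⟨w1, w2, w3, w4, w5⟩ := hw
  have t1 : D.top i = w := top_eq ⟨w1.le, w2⟩ w1 (le_antisymm w4 hcon.2)
  have t2 : D.top j = w := top_eq ⟨hbj.trans_le w1.le, w3⟩ (hbj.trans_lt w1) (le_antisymm hcon.1 w5)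
  have hij : i ≠ j := by rintro rfl; exact lt_irrefl _ hj2
  obtain ⟨z, hzS, z1, z2, hz⟩ := par i j hij hj1.symm (t1.trans t2.symm)
  rw [t1] at z2
  have z3 : D.On i (D.Y z) := ⟨z1.le, z2.le.trans w2⟩
  have z4 : D.On j (D.Y z) := ⟨hbj.trans_le z1.le, z2.le.trans w3⟩
  rcases hz with ⟨h1, h2⟩ | ⟨h1, h2⟩
  · have := hmin z ⟨hzS, z1, z3.2, z4.2, h1.le, h2.le⟩
    linarith
  · have := order hoi hoj z3 z4 hj2
    linarith

/-- A drawing with monotone edges between vertices of `S` in which parallel edges always enclose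
a vertex of `S` has at most `3 |S|` edges. -/
theorem card_edges_le [Finite V] [Finite ι] (D : MonotoneDrawing V ι) (S : Set V)
    (hS : ∀ i, D.bot i ∈ S ∧ D.top i ∈ S)
    (par : ∀ i j, i ≠ j → D.bot i = D.bot j → D.top i = D.top j → ∃ w ∈ S,
      D.Y (D.bot i) < D.Y w ∧ D.Y w < D.Y (D.top i) ∧
      (D.f i (D.Y w) < D.X w ∧ D.X w < D.f j (D.Y w) ∨
        D.f j (D.Y w) < D.X w ∧ D.X w < D.f i (D.Y w))) :
    Nat.card ι ≤ 3 * S.ncard := by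
  choose τ hτ using fun u => exists_height_above D.Y (D.Y u)
  -- Tag 0: rightmost edge, charged to its lower end. Tags 1 and 2: charged to a lowest vertex of
  -- the wedge, off the right or off the left boundary.
  let Charge : ι → S → Fin 3 → Prop := fun i w n =>
    (n = 0 ∧ w.1 = D.bot i ∧
      ∀ j, D.bot j = D.bot i → D.f j (τ (D.bot i)) ≤ D.f i (τ (D.bot i))) ∨
    (n = 1 ∧ ∃ j, D.Next τ i j ∧ D.FirstInWedge S i j w.1 ∧ D.X w.1 < D.f j (D.Y w.1)) ∨
    (n = 2 ∧ ∃ j, D.Next τ i j ∧ D.FirstInWedge S i j w.1 ∧ D.f i (D.Y w.1) < D.X w.1)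
  have hex : ∀ i, ∃ p : S × Fin 3, Charge i p.1 p.2 := by
    intro i
    rcases exists_charge hS hτ par i with h | ⟨j, w, h1, h2, h3 | h3⟩
    · exact ⟨(⟨D.bot i, (hS i).1⟩, 0), Or.inl ⟨rfl, rfl, h⟩⟩
    · exact ⟨(⟨w, h2.1⟩, 1), Or.inr (Or.inl ⟨rfl, j, h1, h2, h3⟩)⟩
    · exact ⟨(⟨w, h2.1⟩, 2), Or.inr (Or.inr ⟨rfl, j, h1, h2, h3⟩)⟩
  choose φ hφ using hex
  have hinj : Function.Injective φ := by
    intro i i' he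
    have h := hφ i
    have h' := hφ i'
    rw [← he] at h'
    rcases h with ⟨n, h1, h2⟩ | ⟨n, j, h1, h2, h3⟩ | ⟨n, j, h1, h2, h3⟩ <;>
    rcases h' with ⟨n', h1', h2'⟩ | ⟨n', j', h1', h2', h3'⟩ | ⟨n', j', h1', h2', h3'⟩ <;>
    first
    | exact absurd (n.symm.trans n') (by decide)
    | skip
    · have hb : D.bot i' = D.bot i := h1'.symm.trans h1
      have e1 := h2 i' hb
      have e2 := h2' i hb.symm
      rw [hb] at e2
      have hτi := hτ (D.bot i)
      have ht' := D.lt i'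
      rw [hb] at ht'
      exact eq_of_interior hτi.1 (hτi.2 _ (D.lt i))
        ⟨hb ▸ hτi.1.le, (hτi.2 _ ht').le⟩ (le_antisymm e2 e1)
    · exact eq_of_first_left hS hτ h1 h2 h3 h1' h2' h3'
    · exact eq_of_first_right hS hτ h1 h2 h3 h1' h2' h3'
  calc Nat.card ι ≤ Nat.card (S × Fin 3) := Nat.card_le_card_of_injective φ hinj
    _ = 3 * S.ncard := by rw [Nat.card_prod, Nat.card_fin, _root_.Nat.card_coe_set_eq, mul_comm]

end Counting

end MonotoneDrawing

end LevelPlanarity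

/-! ### Free curves alongside the edges of a drawing -/

namespace LevelPlanarity

open Filter Topology

namespace MonotoneDrawing

variable {V ι : Type*} (D : MonotoneDrawing V ι)

/-- `(x, y)` is a point of the drawing. -/
def Item (x y : ℝ) : Prop := (∃ v, D.Y v = y ∧ D.X v = x) ∨ ∃ i, D.On i y ∧ D.f i y = x

/-- `(x, y)` lies on an open horizontal segment that joins two consecutive vertices of `C`. -/
def Rung (C : Set V) (x y : ℝ) : Prop :=
  ∃ u ∈ C, ∃ w ∈ C, D.Y u = y ∧ D.Y w = y ∧ D.X u < x ∧ x < D.X w ∧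
    ∀ s, D.X u < s → s < D.X w → ¬ D.Item s y

/-- All conceivable rungs are excluded, drawn or not, so that a curve through free points crosses no
level segment that a visibility extension may contain. -/
def Free (C : Set V) (x y : ℝ) : Prop := ¬ D.Item x y ∧ ¬ D.Rung C x y

/-- A y-monotone curve leads from `(x, y)` up to `(x', y')` whose inner points are free. -/
def Reach (C : Set V) (x y x' y' : ℝ) : Prop :=
  y < y' ∧ ∃ g : ℝ → ℝ, Continuous g ∧ g y = x ∧ g y' = x' ∧
    ∀ s, y < s → s < y' → D.Free C (g s) s

/-- The mirror image in the vertical axis. -/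
def flipX : MonotoneDrawing V ι where
  X v := - D.X v
  Y := D.Y
  bot := D.bot
  top := D.top
  f i t := - D.f i t
  lt := D.lt
  cont i := (D.cont i).neg
  f_bot i := by rw [D.f_bot]
  f_top i := by rw [D.f_top]
  inj u v h := D.inj u v (neg_injective h)
  avoid i v h1 h2 h := D.avoid i v h1 h2 (neg_injective h)
  cross i j hne t h1 h2 h3 h4 h := by
    obtain ⟨v, hv, hx⟩ := D.cross i j hne t h1 h2 h3 h4 (neg_injective h)
    exact ⟨v, hv, by rw [hx]⟩

/-- The mirror image in the horizontal axis. -/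
def flipY : MonotoneDrawing V ι where
  X := D.X
  Y v := - D.Y v
  bot := D.top
  top := D.bot
  f i t := D.f i (-t)
  lt i := neg_lt_neg (D.lt i)
  cont i := (D.cont i).comp continuous_neg
  f_bot i := by rw [neg_neg, D.f_top]
  f_top i := by rw [neg_neg, D.f_bot]
  inj u v h h' := D.inj u v h (neg_injective h')
  avoid i v h1 h2 h := by
    rw [neg_neg] at h
    exact (D.avoid i v (neg_le_neg_iff.1 h2) (neg_le_neg_iff.1 h1) h).symm
  cross i j hne t h1 h2 h3 h4 h := by
    obtain ⟨v, hv, hx⟩ := D.cross i j hne (-t) (by linarith) (by linarith) (by linarith)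
      (by linarith) h
    exact ⟨v, by rw [hv, neg_neg], hx⟩

variable {D} {C : Set V}

theorem on_flipX {i : ι} {t : ℝ} : D.flipX.On i t ↔ D.On i t := Iff.rfl

theorem on_flipY {i : ι} {t : ℝ} : D.flipY.On i t ↔ D.On i (-t) :=
  ⟨fun h => ⟨by have := h.2; simp only [flipY] at this; linarith,
      by have := h.1; simp only [flipY] at this; linarith⟩,
    fun h => ⟨by have := h.2; simp only [flipY]; linarith,
      by have := h.1; simp only [flipY]; linarith⟩⟩

theorem item_flipX {x y : ℝ} : D.flipX.Item x y ↔ D.Item (-x) y := by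
  simp only [Item, on_flipX]
  simp only [flipX, neg_eq_iff_eq_neg]

theorem item_flipY {x y : ℝ} : D.flipY.Item x y ↔ D.Item x (-y) := by
  simp only [Item, on_flipY]
  simp only [flipY, neg_eq_iff_eq_neg]

theorem rung_flipX {x y : ℝ} : D.flipX.Rung C x y ↔ D.Rung C (-x) y := by
  constructor
  · rintro ⟨u, hu, w, hw, h1, h2, h3, h4, h5⟩
    simp only [item_flipX] at h5
    simp only [flipX] at *
    refine ⟨w, hw, u, hu, h2, h1, by linarith, by linarith, fun s hs hs' => ?_⟩
    have := h5 (-s) (by linarith) (by linarith)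
    rwa [neg_neg] at this
  · rintro ⟨u, hu, w, hw, h1, h2, h3, h4, h5⟩
    refine ⟨w, hw, u, hu, h2, h1, ?_, ?_, fun s hs hs' => ?_⟩
    · simp only [flipX]; linarith
    · simp only [flipX]; linarith
    · rw [item_flipX]
      simp only [flipX] at hs hs'
      exact h5 (-s) (by linarith) (by linarith)

theorem rung_flipY {x y : ℝ} : D.flipY.Rung C x y ↔ D.Rung C x (-y) := by
  simp only [Rung, item_flipY]
  simp only [flipY, neg_eq_iff_eq_neg]

theorem free_flipX {x y : ℝ} : D.flipX.Free C x y ↔ D.Free C (-x) y := by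
  simp only [Free, item_flipX, rung_flipX]

theorem free_flipY {x y : ℝ} : D.flipY.Free C x y ↔ D.Free C x (-y) := by
  simp only [Free, item_flipY, rung_flipY]

theorem Reach.of_flipX {x y x' y' : ℝ} (h : D.flipX.Reach C x y x' y') :
    D.Reach C (-x) y (-x') y' := by
  obtain ⟨h1, g, hg, h2, h3, h4⟩ := h
  exact ⟨h1, fun s => - g s, hg.neg, by simp [h2], by simp [h3],
    fun s hs hs' => free_flipX.1 (h4 s hs hs')⟩

theorem Reach.of_flipY {x y x' y' : ℝ} (h : D.flipY.Reach C x y x' y') :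
    D.Reach C x' (-y') x (-y) := by
  obtain ⟨h1, g, hg, h2, h3, h4⟩ := h
  refine ⟨neg_lt_neg h1, fun s => g (-s), hg.comp continuous_neg, by simp [h3],
    by simp [h2], fun s hs hs' => ?_⟩
  have := free_flipY.1 (h4 (-s) (by linarith) (by linarith))
  rwa [neg_neg] at this

theorem Reach.trans {x y x' y' x'' y'' : ℝ} (h : D.Reach C x y x' y') (hf : D.Free C x' y')
    (h' : D.Reach C x' y' x'' y'') : D.Reach C x y x'' y'' := by
  obtain ⟨h1, g, hg, h2, h3, h4⟩ := h
  obtain ⟨h1', g', hg', h2', h3', h4'⟩ := h'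
  refine ⟨h1.trans h1', fun s => if s ≤ y' then g s else g' s,
    hg.if_le hg' continuous_id continuous_const (fun s hs => by rw [hs, h3, h2']),
    by simp [h1.le, h2], by simp [not_le.2 h1', h3'], fun s hs hs' => ?_⟩
  rcases lt_trichotomy s y' with hlt | rfl | hlt
  · simpa [hlt.le] using h4 s hs hlt
  · simpa [h3] using hf
  · simpa [not_le.2 hlt] using h4' s hlt hs'

/-- A vertical segment. -/
theorem reach_vertical {c y y' : ℝ} (h : y < y') (hf : ∀ s, y < s → s < y' → D.Free C c s) :
    D.Reach C c y c y' :=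
  ⟨h, fun _ => c, continuous_const, rfl, rfl, hf⟩

theorem free_of_generic {s t : ℝ} (h1 : ∀ v, D.Y v ≠ t) (h2 : ∀ j, D.On j t → D.f j t ≠ s) :
    D.Free C s t := by
  refine ⟨?_, ?_⟩
  · rintro (⟨v, hv, -⟩ | ⟨j, hj, hs⟩)
    · exact h1 v hv
    · exact h2 j hj hs
  · rintro ⟨u, -, w, -, hu, -⟩
    exact h1 u hu

theorem eventually_generic [Finite V] (y : ℝ) : ∀ᶠ t in 𝓝[≠] y, ∀ v, D.Y v ≠ t := by
  refine eventually_all.2 fun v => ?_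
  by_cases hv : D.Y v = y
  · filter_upwards [self_mem_nhdsWithin] with t ht h using ht (h.symm.trans hv)
  · filter_upwards [mem_nhdsWithin_of_mem_nhds (isOpen_ne.mem_nhds (Ne.symm hv))] with t ht h
      using ht h.symm

theorem eventually_not_on {j : ι} {y : ℝ} (h : ¬ D.On j y) : ∀ᶠ t in 𝓝 y, ¬ D.On j t :=
  (isClosed_Icc (a := D.Y (D.bot j)) (b := D.Y (D.top j))).isOpen_compl.mem_nhds h

/-- Edges that meet no point of the segment from `(x, y)` to `(c, y)`, except possibly `(x, y)`,
keep this property at neighbouring heights `t`, where `x` is replaced by `φ t`. -/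
theorem eventually_near [Finite ι] {x y c : ℝ} (hc : x < c)
    (hI : ∀ s, x < s → s ≤ c → ¬ D.Item s y) {φ : ℝ → ℝ} (hφ : Continuous φ) (hx : φ y = x) :
    ∀ᶠ t in 𝓝 y, φ t < c ∧
      ∀ j, D.On j t → (D.On j y ∧ D.f j y = x) ∨ D.f j t < φ t ∨ c < D.f j t := by
  refine Eventually.and ?_ (eventually_all.2 fun j => ?_)
  · exact hφ.continuousAt.eventually_lt continuousAt_const (by rwa [hx])
  · by_cases hj : D.On j y
    · rcases lt_trichotomy (D.f j y) x with h | h | h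
      · filter_upwards [(D.cont j).continuousAt.eventually_lt hφ.continuousAt (by rwa [hx])]
          with t ht _ using Or.inr (Or.inl ht)
      · exact Eventually.of_forall fun t _ => Or.inl ⟨hj, h⟩
      · have h' : c < D.f j y := by
          by_contra hle
          exact hI _ h (not_lt.1 hle) (Or.inr ⟨j, hj, rfl⟩)
        filter_upwards [continuousAt_const.eventually_lt (D.cont j).continuousAt h']
          with t ht _ using Or.inr (Or.inr ht)
    · filter_upwards [eventually_not_on hj] with t ht h using absurd h ht

/-- Edges are closed and finite in number, and rungs occur only at vertex heights, which are
isolated. -/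
theorem eventually_free [Finite V] [Finite ι] {c y : ℝ} (h : D.Free C c y) :
    ∀ᶠ t in 𝓝 y, D.Free C c t := by
  have h1 : ∀ᶠ t in 𝓝 y, ∀ j, D.On j t → D.f j t ≠ c := by
    refine eventually_all.2 fun j => ?_
    by_cases hj : D.On j y
    · have hne : D.f j y ≠ c := fun he => h.1 (Or.inr ⟨j, hj, he⟩)
      filter_upwards [(D.cont j).continuousAt.eventually_ne hne] with t ht _ using ht
    · filter_upwards [eventually_not_on hj] with t ht h using absurd h ht
  filter_upwards [h1, eventually_nhdsWithin_iff.1 (D.eventually_generic y)] with t ht1 ht2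
  by_cases hty : t = y
  · rwa [hty]
  · exact free_of_generic (ht2 hty) ht1

theorem item_vertex (v : V) : D.Item (D.X v) (D.Y v) := Or.inl ⟨v, rfl, rfl⟩

theorem finite_items [Finite V] [Finite ι] (y : ℝ) : {x | D.Item x y}.Finite := by
  refine ((Set.finite_range D.X).union (Set.finite_range fun i => D.f i y)).subset ?_
  rintro x (⟨v, -, rfl⟩ | ⟨i, -, rfl⟩)
  · exact Or.inl ⟨v, rfl⟩
  · exact Or.inr ⟨i, rfl⟩

/-- Some vertex of `C` is placed at `(x, y)`. -/
def CVertex (D : MonotoneDrawing V ι) (C : Set V) (x y : ℝ) : Prop :=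
  ∃ u ∈ C, D.Y u = y ∧ D.X u = x

/-- A rung covering part of the gap would have to start at `a`, which is not a vertex of `C`. -/
theorem free_of_gap {a c y : ℝ} (ha : D.Item a y) (hC : ¬ D.CVertex C a y)
    (hI : ∀ s, a < s → s ≤ c → ¬ D.Item s y) {s : ℝ} (h1 : a < s) (h2 : s ≤ c) :
    D.Free C s y := by
  refine ⟨hI s h1 h2, ?_⟩
  rintro ⟨u, hu, w, -, rfl, -, h3, h4, h5⟩
  rcases lt_trichotomy (D.X u) a with h | h | h
  · exact h5 a h (h1.trans h4) ha
  · exact hC ⟨u, hu, rfl, h⟩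
  · exact hI _ h (h3.le.trans h2) (item_vertex u)

theorem exists_gap [Finite V] [Finite ι] (x y : ℝ) {b : ℝ} (hb : x < b) :
    ∃ c, x < c ∧ c < b ∧ ∀ s, x < s → s ≤ c → ¬ D.Item s y := by
  have h : ∀ᶠ c in 𝓝[>] x, ∀ s ∈ {s | D.Item s y}, x < s → c < s := by
    refine (eventually_all_finite (D.finite_items y)).2 fun s _ => ?_
    by_cases hs : x < s
    · filter_upwards [Ioo_mem_nhdsGT hs] with c hc _ using hc.2
    · exact Eventually.of_forall fun c h => absurd h hs
  obtain ⟨c, hc, h1, h2⟩ := (h.and (Ioo_mem_nhdsGT hb)).exists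
  exact ⟨c, h1, h2, fun s hs hs' hI => absurd (hc s hI hs) (not_lt.2 hs')⟩

theorem not_cvertex_of_interior {i : ι} {t : ℝ} (hb : D.Y (D.bot i) < t)
    (ht : t < D.Y (D.top i)) : ¬ D.CVertex C (D.f i t) t := by
  rintro ⟨u, -, rfl, hu⟩
  rw [bot_eq ⟨hb.le, ht.le⟩ ht hu.symm] at hb
  exact lt_irrefl _ hb

theorem eventually_free_right [Finite V] [Finite ι] {i : ι} {t c : ℝ} (hb : D.Y (D.bot i) < t)
    (ht : t < D.Y (D.top i)) (hc : D.f i t < c)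
    (hI : ∀ s, D.f i t < s → s ≤ c → ¬ D.Item s t) :
    ∀ᶠ t' in 𝓝 t, D.f i t' < c ∧ ∀ s, D.f i t' < s → s ≤ c → D.Free C s t' := by
  filter_upwards [eventually_near hc hI (D.cont i) rfl,
    eventually_nhdsWithin_iff.1 (D.eventually_generic t)] with t' h1 h2
  refine ⟨h1.1, fun s hs hs' => ?_⟩
  by_cases htt : t' = t
  · subst htt
    exact free_of_gap (Or.inr ⟨i, ⟨hb.le, ht.le⟩, rfl⟩) (not_cvertex_of_interior hb ht) hI hs hs'
  · refine free_of_generic (h2 htt) fun j hj he => ?_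
    rcases h1.2 j hj with ⟨h3, h4⟩ | h3 | h3
    · have := eq_of_interior hb ht h3 h4.symm
      subst this
      linarith
    · linarith
    · linarith

/-- One can walk from the lower end of an edge upwards along its right side. -/
theorem reach_right [Finite V] [Finite ι] {i : ι} {t₀ c : ℝ} (hb : D.Y (D.bot i) < t₀)
    (ht : t₀ < D.Y (D.top i)) (hc : D.f i t₀ < c)
    (hI : ∀ s, D.f i t₀ < s → s ≤ c → ¬ D.Item s t₀) :
    D.Reach C (D.X (D.bot i)) (D.Y (D.bot i)) c t₀ := by
  set p := D.Y (D.bot i) with hp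
  set q := D.Y (D.top i) with hq
  -- `M` is steep enough that `(c, t₀)` lies within the strip of width `M * (t - p)` to the right of
  -- the edge.
  obtain ⟨M, hM0, hM⟩ : ∃ M : ℝ, 0 < M ∧ c < D.f i t₀ + M * (t₀ - p) := by
    have : 0 < t₀ - p := by linarith
    refine ⟨(c - D.f i t₀) / (t₀ - p) + 1, ?_, ?_⟩
    · have : 0 < c - D.f i t₀ := by linarith
      positivity
    · rw [add_mul, div_mul_cancel₀ _ this.ne']
      linarith
  -- Admissible positions at height `t`: the shrinking strip forces convergence to the lower end,
  -- and the last clause pins the curve to `c` at height `t₀`. A continuous selection from these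
  -- convex sets exists because constants are admissible locally.
  let F : Set.Ioo p q → Set ℝ := fun t => {s | D.f i t < s ∧ s < D.f i t + M * (t - p) ∧
    (∀ r, D.f i t < r → r ≤ s → D.Free C r t) ∧ (t.1 = t₀ → s = c)}
  have hconv : ∀ t, Convex ℝ (F t) := by
    intro t
    apply Set.OrdConnected.convex
    refine ⟨fun a ha b hb s hs => ⟨ha.1.trans_le hs.1, hs.2.trans_lt hb.2.1,
      fun r h1 h2 => hb.2.2.1 r h1 (h2.trans hs.2), fun h => ?_⟩⟩
    have h1 := ha.2.2.2 h
    have h2 := hb.2.2.2 h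
    have h3 := hs.1
    have h4 := hs.2
    linarith
  have hloc : ∀ t : Set.Ioo p q, ∃ s : ℝ, ∀ᶠ t' in 𝓝 t, s ∈ F t' := by
    rintro ⟨t, ht1, ht2⟩
    have key : ∀ s, D.f i t < s → s < D.f i t + M * (t - p) →
        (∀ r, D.f i t < r → r ≤ s → ¬ D.Item r t) → (∀ᶠ t' in 𝓝 t, t' = t₀ → s = c) →
        ∀ᶠ t' in 𝓝 (⟨t, ht1, ht2⟩ : Set.Ioo p q), s ∈ F t' := by
      intro s h1 h2 h3 h4
      have h5 : ∀ᶠ t' in 𝓝 t, s < D.f i t' + M * (t' - p) :=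
        continuousAt_const.eventually_lt ((D.cont i).add
          (continuous_const.mul (continuous_id.sub continuous_const))).continuousAt h2
      have h6 := (eventually_free_right (C := C) ht1 ht2 h1 h3).and (h4.and h5)
      filter_upwards [(continuous_subtype_val.tendsto
        (⟨t, ht1, ht2⟩ : Set.Ioo p q)).eventually h6] with t' e
      exact ⟨e.1.1, e.2.2, e.1.2, e.2.1⟩
    by_cases htt : t = t₀
    · subst htt
      exact ⟨c, key c hc hM hI (Eventually.of_forall fun _ _ => rfl)⟩
    · have hpos : 0 < M * (t - p) := mul_pos hM0 (by linarith)
      obtain ⟨s, h1, h2, h3⟩ := D.exists_gap (D.f i t) t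
        (b := D.f i t + M * (t - p)) (by linarith)
      refine ⟨s, key s h1 h2 h3 ?_⟩
      filter_upwards [isOpen_ne.mem_nhds htt] with t' h h' using absurd h' h
  obtain ⟨g, hg⟩ := exists_continuous_forall_mem_convex_of_local_const hconv hloc
  classical
  let G : ℝ → ℝ := fun t => if h : t ∈ Set.Ioo p q then g ⟨t, h⟩ else D.X (D.bot i)
  have hGin : ∀ t (h : t ∈ Set.Ioo p q), G t = g ⟨t, h⟩ := fun t h => dif_pos h
  have hGp : G p = D.X (D.bot i) := dif_neg fun h => lt_irrefl _ h.1
  have hGc : ContinuousOn G (Set.Ioo p q) := by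
    rw [continuousOn_iff_continuous_domRestrict]
    convert g.continuous using 1
    ext t
    exact hGin t t.2
  have hG : ContinuousOn G (Set.Icc p t₀) := by
    intro t htm
    rcases eq_or_lt_of_le htm.1 with h | h
    · subst h
      have e1 : Tendsto (D.f i) (𝓝[Set.Icc p t₀] p) (𝓝 (D.X (D.bot i))) := by
        rw [← D.f_bot i]
        exact (D.cont i).continuousAt.tendsto.mono_left nhdsWithin_le_nhds
      have e2 : Tendsto (fun t => D.f i t + M * (t - p)) (𝓝[Set.Icc p t₀] p)
          (𝓝 (D.X (D.bot i))) := by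
        have : D.X (D.bot i) = D.f i p + M * (p - p) := by rw [← D.f_bot i]; ring
        rw [this]
        exact ((D.cont i).add (continuous_const.mul
          (continuous_id.sub continuous_const))).continuousAt.tendsto.mono_left nhdsWithin_le_nhds
      have hval : ∀ t ∈ Set.Icc p t₀, D.f i t ≤ G t ∧ G t ≤ D.f i t + M * (t - p) := by
        intro t htm
        rcases eq_or_lt_of_le htm.1 with h | h
        · rw [← h, hGp, ← D.f_bot i]
          exact ⟨le_rfl, by rw [sub_self, mul_zero, add_zero]⟩
        · have hm : t ∈ Set.Ioo p q := ⟨h, htm.2.trans_lt ht⟩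
          rw [hGin t hm]
          exact ⟨(hg ⟨t, hm⟩).1.le, (hg ⟨t, hm⟩).2.1.le⟩
      unfold ContinuousWithinAt
      rw [hGp]
      refine tendsto_of_tendsto_of_tendsto_of_le_of_le' e1 e2 ?_ ?_
      · filter_upwards [self_mem_nhdsWithin] with t h using (hval t h).1
      · filter_upwards [self_mem_nhdsWithin] with t h using (hval t h).2
    · exact (hGc.continuousAt (isOpen_Ioo.mem_nhds ⟨h, htm.2.trans_lt ht⟩)).continuousWithinAt
  refine ⟨hb, Set.IccExtend hb.le ((Set.Icc p t₀).domRestrict G), ?_, ?_, ?_, fun s h1 h2 => ?_⟩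
  · exact (continuousOn_iff_continuous_domRestrict.1 hG).Icc_extend'
  · rw [Set.IccExtend_of_mem _ _ (Set.left_mem_Icc.2 hb.le)]
    exact hGp
  · rw [Set.IccExtend_of_mem _ _ (Set.right_mem_Icc.2 hb.le)]
    exact (hGin t₀ ⟨hb, ht⟩).trans ((hg ⟨t₀, hb, ht⟩).2.2.2 rfl)
  · rw [Set.IccExtend_of_mem _ _ ⟨h1.le, h2.le⟩]
    have hm : s ∈ Set.Ioo p q := ⟨h1, h2.trans ht⟩
    change D.Free C (G s) s
    rw [hGin s hm]
    exact (hg ⟨s, hm⟩).2.2.1 _ (hg ⟨s, hm⟩).1 le_rfl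

/-- From a vertex `u` one can walk upwards to the points above `(c, Y u)`, if no point of the
drawing lies to the right of `u` up to `c`. -/
theorem eventually_reach_of_vertex [Finite V] [Finite ι] (u : V) {c : ℝ} (hc : D.X u < c)
    (hI : ∀ s, D.X u < s → s ≤ c → ¬ D.Item s (D.Y u)) :
    ∀ᶠ t in 𝓝[>] (D.Y u), D.Reach C (D.X u) (D.Y u) c t := by
  have hgen : ∀ᶠ t in 𝓝[>] (D.Y u), ∀ v, D.Y v ≠ t :=
    (D.eventually_generic (D.Y u)).filter_mono (nhdsWithin_mono _ fun t ht => ne_of_gt ht)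
  by_cases hup : {j | D.bot j = u}.Nonempty
  · obtain ⟨τ, hτ1, hτ2⟩ := exists_height_above D.Y (D.Y u)
    -- Follow the rightmost edge leaving `u` upwards, so that no other edge from `u` is in the way.
    obtain ⟨i, hi, hmax⟩ := Set.exists_max_image _ (fun j => D.f j τ) (Set.toFinite _) hup
    have hi : D.bot i = u := hi
    subst hi
    filter_upwards [hgen, mem_nhdsWithin_of_mem_nhds (eventually_near hc hI (D.cont i) (D.f_bot i)),
      Ioo_mem_nhdsGT hτ1] with t h1 h2 h3
    have hti : t < D.Y (D.top i) := h3.2.trans (hτ2 _ (D.lt i))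
    refine reach_right h3.1 hti h2.1 fun s hs hs' => ?_
    rintro (⟨v, hv, -⟩ | ⟨j, hj, rfl⟩)
    · exact h1 v hv
    · rcases h2.2 j hj with ⟨h4, h5⟩ | h4 | h4
      · have hbj : D.bot j = D.bot i := bot_eq h4 (h3.1.trans_le hj.2) h5
        have hlj := D.lt j
        have e := order_lt (t := τ) ⟨h3.1.le, hti.le⟩ hj hτ1 (hτ2 _ (D.lt i))
          ⟨by rw [hbj]; exact hτ1.le, (hτ2 _ (by rwa [hbj] at hlj)).le⟩ hs
        exact absurd (hmax j hbj) (not_le.2 e)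
      · linarith
      · linarith
  -- No edge leaves `u` upwards, so a straight line to `(c, t)` is free.
  · have hnear := (hgen.and (mem_nhdsWithin_of_mem_nhds
      (eventually_near hc hI (φ := fun _ => D.X u) continuous_const rfl)))
    obtain ⟨b, hb, hsub⟩ := mem_nhdsGT_iff_exists_Ioo_subset.1 hnear
    filter_upwards [Ioo_mem_nhdsGT hb] with t ht
    have h0 : 0 < t - D.Y u := sub_pos.2 ht.1
    refine ⟨ht.1, fun s => D.X u + (c - D.X u) * ((s - D.Y u) / (t - D.Y u)), by fun_prop,
      by simp, by simp [div_self h0.ne'], fun s hs hs' => ?_⟩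
    obtain ⟨h1, h2⟩ := hsub ⟨hs, hs'.trans ht.2⟩
    have r0 : 0 < (s - D.Y u) / (t - D.Y u) := div_pos (sub_pos.2 hs) h0
    have r1 : (s - D.Y u) / (t - D.Y u) < 1 := (div_lt_one h0).2 (by linarith)
    have hcu : 0 < c - D.X u := by linarith
    refine free_of_generic h1 fun j hj he => ?_
    rcases h2.2 j hj with ⟨h4, h5⟩ | h4 | h4
    · exact hup ⟨j, bot_eq h4 (hs.trans_le hj.2) h5⟩
    · nlinarith
    · nlinarith

theorem exists_height_below [Finite V] (Y : V → ℝ) (t : ℝ) :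
    ∃ s, s < t ∧ ∀ v, Y v < t → Y v < s := by
  obtain ⟨s, h1, h2⟩ := exists_height_above (fun v => - Y v) (-t)
  exact ⟨-s, by linarith, fun v hv => by have := h2 v (by linarith); linarith⟩

/-- Walking upwards along the right side of the rightmost edge that reaches `(x, y)` from below. -/
theorem eventually_reach_of_edge [Finite V] [Finite ι] {x y c : ℝ} (hc : x < c)
    (hC : ¬ D.CVertex C x y)
    (hI : ∀ s, x < s → s ≤ c → ¬ D.Item s y) {i₀ : ι} (h1 : D.Y (D.bot i₀) < y)
    (h2 : y ≤ D.Y (D.top i₀)) (h3 : D.f i₀ y = x) :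
    ∃ i, D.Y (D.bot i) < y ∧ y ≤ D.Y (D.top i) ∧ D.f i y = x ∧
      (∀ᶠ t in 𝓝[<] y, D.Reach C (D.X (D.bot i)) (D.Y (D.bot i)) c t) ∧
      ∀ᶠ t in 𝓝[>] y, D.Reach C (D.X (D.bot i)) (D.Y (D.bot i)) c t := by
  obtain ⟨τ, hτ1, hτ2⟩ := exists_height_below D.Y y
  obtain ⟨i, ⟨hi1, hi2, hi3⟩, hmax⟩ := Set.exists_max_image
    {j | D.Y (D.bot j) < y ∧ y ≤ D.Y (D.top j) ∧ D.f j y = x} (fun j => D.f j τ)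
    (Set.toFinite _) ⟨i₀, h1, h2, h3⟩
  have hgen : ∀ᶠ t in 𝓝[<] y, ∀ v, D.Y v ≠ t :=
    (D.eventually_generic y).filter_mono (nhdsWithin_mono _ fun t ht => ne_of_lt ht)
  have hlow : ∀ᶠ t in 𝓝[<] y, D.Reach C (D.X (D.bot i)) (D.Y (D.bot i)) c t := by
    filter_upwards [hgen, mem_nhdsWithin_of_mem_nhds (eventually_near hc hI (D.cont i) hi3),
      Ioo_mem_nhdsLT hτ1] with t h1 h2 h3
    have hbi : D.Y (D.bot i) < t := (hτ2 _ hi1).trans h3.1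
    have hti : t < D.Y (D.top i) := h3.2.trans_le hi2
    refine reach_right hbi hti h2.1 fun s hs hs' => ?_
    rintro (⟨v, hv, -⟩ | ⟨j, hj, rfl⟩)
    · exact h1 v hv
    · rcases h2.2 j hj with ⟨h4, h5⟩ | h4 | h4
      · have hbj : D.Y (D.bot j) < y := hj.1.trans_lt h3.2
        have e := order_lt (t := τ) ⟨hbi.le, hti.le⟩ hj (hτ2 _ hi1) (hτ1.trans_le hi2)
          ⟨(hτ2 _ hbj).le, (hτ1.trans_le h4.2).le⟩ hs
        exact absurd (hmax j ⟨hbj, h4.2, h5⟩) (not_le.2 e)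
      · linarith
      · linarith
  refine ⟨i, hi1, hi2, hi3, hlow, ?_⟩
  -- No rung starts at `(x, y)`, so a short vertical segment at `c` passes through height `y`.
  have hfree : D.Free C c y :=
    free_of_gap (Or.inr ⟨i, ⟨hi1.le, hi2⟩, hi3⟩) hC hI hc le_rfl
  obtain ⟨ε, hε, hball⟩ := Metric.eventually_nhds_iff_ball.1 (eventually_free hfree)
  have hcol : ∀ t, y - ε < t → t < y + ε → D.Free C c t := fun t h1 h2 =>
    hball t (by rw [Real.ball_eq_Ioo]; exact ⟨h1, h2⟩)
  obtain ⟨t₁, ht1, ht2⟩ := (hlow.and (Ioo_mem_nhdsLT (show y - ε < y by linarith))).exists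
  filter_upwards [Ioo_mem_nhdsGT (show y < y + ε by linarith)] with t ht
  have ht3 := ht2.1
  have ht4 := ht2.2
  have ht5 := ht.1
  have ht6 := ht.2
  exact ht1.trans (hcol t₁ (by linarith) (by linarith))
    (reach_vertical (by linarith) fun s hs hs' => hcol s (by linarith) (by linarith))

end MonotoneDrawing

end LevelPlanarity

/-! ### Coloured drawings: all vertices of the cover have one colour -/

namespace LevelPlanarity

open Filter Topology

/-- A monotone drawing with a vertex cover `C` whose vertices are coloured such that vertices of
`C` that see each other have the same colour. -/
structure ColoredDrawing (V ι κ : Type*) extends MonotoneDrawing V ι where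
  C : Set V
  col : V → κ
  cover : ∀ i, bot i ∈ C ∨ top i ∈ C
  covered : ∀ v ∉ C, ∃ i, bot i = v ∨ top i = v
  col_edge : ∀ i, bot i ∈ C → top i ∈ C → col (bot i) = col (top i)
  col_reach : ∀ u ∈ C, ∀ w ∈ C, toMonotoneDrawing.Reach C (X u) (Y u) (X w) (Y w) → col u = col w
  col_rung : ∀ u ∈ C, ∀ w ∈ C, Y u = Y w → X u < X w →
    (∀ s, X u < s → s < X w → ¬ toMonotoneDrawing.Item s (Y u)) → col u = col w

namespace ColoredDrawing

open MonotoneDrawing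

variable {V ι κ : Type*} (D : ColoredDrawing V ι κ)

/-- The mirror image in the vertical axis. -/
def flipX : ColoredDrawing V ι κ where
  toMonotoneDrawing := D.toMonotoneDrawing.flipX
  C := D.C
  col := D.col
  cover := D.cover
  covered := D.covered
  col_edge := D.col_edge
  col_reach u hu w hw h := by
    refine D.col_reach u hu w hw ?_
    have := h.of_flipX
    simpa only [MonotoneDrawing.flipX, neg_neg] using this
  col_rung u hu w hw h1 h2 h3 := by
    refine (D.col_rung w hw u hu h1.symm (neg_lt_neg_iff.1 h2) fun s hs hs' hI => ?_).symm
    refine h3 (-s) (neg_lt_neg hs') (neg_lt_neg hs) (item_flipX.2 ?_)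
    rw [neg_neg]
    exact (show D.Y u = D.Y w from h1) ▸ hI

/-- The mirror image in the horizontal axis. -/
def flipY : ColoredDrawing V ι κ where
  toMonotoneDrawing := D.toMonotoneDrawing.flipY
  C := D.C
  col := D.col
  cover i := (D.cover i).symm
  covered v hv := (D.covered v hv).imp fun _ h => h.symm
  col_edge i h1 h2 := (D.col_edge i h2 h1).symm
  col_reach u hu w hw h := by
    refine (D.col_reach w hw u hu ?_).symm
    have := h.of_flipY
    simpa only [MonotoneDrawing.flipY, neg_neg] using this
  col_rung u hu w hw h1 h2 h3 := by
    refine D.col_rung u hu w hw (neg_injective h1) h2 fun s hs hs' hI => ?_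
    refine h3 s hs hs' (item_flipY.2 ?_)
    simpa only [MonotoneDrawing.flipY, neg_neg] using hI

/-- From `(x, y)` a vertex of `C` with colour `k` can be reached along an edge upwards. -/
def UpC (x y : ℝ) (k : κ) : Prop :=
  (∃ u ∈ D.C, D.Y u = y ∧ D.X u = x ∧ D.col u = k) ∨
    ∃ i, D.top i ∈ D.C ∧ D.Y (D.bot i) ≤ y ∧ y < D.Y (D.top i) ∧ D.f i y = x ∧ D.col (D.top i) = k

/-- From `(x, y)` a vertex of `C` with colour `k` can be reached along an edge downwards. -/
def DnC (x y : ℝ) (k : κ) : Prop :=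
  (∃ u ∈ D.C, D.Y u = y ∧ D.X u = x ∧ D.col u = k) ∨
    ∃ i, D.bot i ∈ D.C ∧ D.Y (D.bot i) < y ∧ y ≤ D.Y (D.top i) ∧ D.f i y = x ∧ D.col (D.bot i) = k

def AllC (x y : ℝ) (k : κ) : Prop := D.UpC x y k ∨ D.DnC x y k

variable {D} {x y c : ℝ} {k k' : κ}

theorem dnC_flipX : D.flipX.DnC x y k ↔ D.DnC (-x) y k := by
  simp only [DnC, flipX, MonotoneDrawing.flipX, neg_eq_iff_eq_neg]

theorem upC_flipX : D.flipX.UpC x y k ↔ D.UpC (-x) y k := by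
  simp only [UpC, flipX, MonotoneDrawing.flipX, neg_eq_iff_eq_neg]

theorem dnC_flipY : D.flipY.DnC x y k ↔ D.UpC x (-y) k := by
  simp only [UpC, DnC, flipY, MonotoneDrawing.flipY, neg_eq_iff_eq_neg, neg_lt, le_neg]
  simp only [and_comm, and_left_comm]

theorem upC_flipY : D.flipY.UpC x y k ↔ D.DnC x (-y) k := by
  simp only [UpC, DnC, flipY, MonotoneDrawing.flipY, neg_eq_iff_eq_neg, lt_neg, neg_le]
  simp only [and_comm, and_left_comm]

theorem cvertex_flipX : D.flipX.CVertex D.flipX.C x y ↔ D.CVertex D.C (-x) y := by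
  simp only [CVertex, flipX, MonotoneDrawing.flipX, neg_eq_iff_eq_neg]

theorem cvertex_flipY : D.flipY.CVertex D.flipY.C x y ↔ D.CVertex D.C x (-y) := by
  simp only [CVertex, flipY, MonotoneDrawing.flipY, neg_eq_iff_eq_neg]

theorem DnC.item (h : D.DnC x y k) : D.Item x y := by
  rcases h with ⟨u, -, h1, h2, -⟩ | ⟨i, -, h1, h2, h3, -⟩
  · exact Or.inl ⟨u, h1, h2⟩
  · exact Or.inr ⟨i, ⟨h1.le, h2⟩, h3⟩

theorem UpC.item (h : D.UpC x y k) : D.Item x y := by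
  rcases h with ⟨u, -, h1, h2, -⟩ | ⟨i, -, h1, h2, h3, -⟩
  · exact Or.inl ⟨u, h1, h2⟩
  · exact Or.inr ⟨i, ⟨h1, h2.le⟩, h3⟩

theorem UpC.eq_col {u : V} (hu : u ∈ D.C) (h : D.UpC (D.X u) (D.Y u) k) : k = D.col u := by
  rcases h with ⟨w, -, h1, h2, rfl⟩ | ⟨i, h0, h1, h2, h3, rfl⟩
  · rw [D.inj w u h2 h1]
  · have := bot_eq ⟨h1, h2.le⟩ h2 h3
    subst this
    exact (D.col_edge i hu h0).symm

theorem DnC.eq_col {u : V} (hu : u ∈ D.C) (h : D.DnC (D.X u) (D.Y u) k) : k = D.col u := by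
  rcases h with ⟨w, -, h1, h2, rfl⟩ | ⟨i, h0, h1, h2, h3, rfl⟩
  · rw [D.inj w u h2 h1]
  · have := top_eq ⟨h1.le, h2⟩ h1 h3
    subst this
    exact D.col_edge i h0 hu

section Reaching

variable [Finite V] [Finite ι]

/-- The curve starts at the lower end of the rightmost edge arriving from below, which need not be
the edge giving `k`. Hence only some downward colour of the point is obtained. If the point is
itself a vertex of `C`, the curve starts there. -/
theorem DnC.reach_right (hc : x < c) (hI : ∀ s, x < s → s ≤ c → ¬ D.Item s y)
    (h : D.DnC x y k) : ∃ B ∈ D.C, D.DnC x y (D.col B) ∧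
      (∀ᶠ t in 𝓝[>] y, D.Reach D.C (D.X B) (D.Y B) c t) ∧
      (¬ D.CVertex D.C x y → ∀ᶠ t in 𝓝[<] y, D.Reach D.C (D.X B) (D.Y B) c t) := by
  by_cases hC : D.CVertex D.C x y
  · obtain ⟨u, hu, rfl, rfl⟩ := id hC
    exact ⟨u, hu, Or.inl ⟨u, hu, rfl, rfl, rfl⟩, eventually_reach_of_vertex u hc hI,
      fun h => absurd hC h⟩
  · rcases h with ⟨u, hu, h1, h2, -⟩ | ⟨i, hi, h1, h2, h3, -⟩
    · exact absurd ⟨u, hu, h1, h2⟩ hC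
    obtain ⟨j, j1, j2, j3, j4, j5⟩ := eventually_reach_of_edge hc hC hI h1 h2 h3
    have hj : D.bot j ∈ D.C := by
      -- Distinct edges meet here in a vertex outside `C`. It is the upper end of `j`, so the cover
      -- contains the lower end.
      by_cases hij : i = j
      · rwa [← hij]
      obtain ⟨v, rfl, hv⟩ := D.cross i j hij y h1.le h2 j1.le j2 (h3.trans j3.symm)
      refine (D.cover j).resolve_right fun htop => hC ⟨_, htop, ?_⟩
      rw [top_eq ⟨j1.le, j2⟩ j1 (by rw [j3, hv, h3])]
      exact ⟨rfl, hv.trans h3⟩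
    exact ⟨D.bot j, hj, Or.inr ⟨j, hj, j1, j2, j3, rfl⟩, j5, fun _ => j4⟩

theorem DnC.reach_left (hc : c < x) (hI : ∀ s, c ≤ s → s < x → ¬ D.Item s y)
    (h : D.DnC x y k) : ∃ B ∈ D.C, D.DnC x y (D.col B) ∧
      (∀ᶠ t in 𝓝[>] y, D.Reach D.C (D.X B) (D.Y B) c t) ∧
      (¬ D.CVertex D.C x y → ∀ᶠ t in 𝓝[<] y, D.Reach D.C (D.X B) (D.Y B) c t) := by
  obtain ⟨B, hB, h1, h2, h3⟩ := DnC.reach_right (D := D.flipX) (x := -x) (c := -c) (y := y) (k := k)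
    (neg_lt_neg hc)
    (fun s hs hs' hs'' => hI (-s) (by linarith) (by linarith) (item_flipX.1 hs''))
    (dnC_flipX.2 (by rwa [neg_neg]))
  rw [dnC_flipX, neg_neg] at h1
  have key : ∀ t, D.flipX.Reach D.flipX.C (D.flipX.X B) (D.flipX.Y B) (-c) t →
      D.Reach D.C (D.X B) (D.Y B) c t := fun t ht => by
    have := Reach.of_flipX (D := D.toMonotoneDrawing) ht
    simpa only [flipX, MonotoneDrawing.flipX, neg_neg] using this
  refine ⟨B, hB, h1, h2.mono key, fun hC => (h3 ?_).mono key⟩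
  rwa [cvertex_flipX, neg_neg]

theorem UpC.reach_right (hc : x < c) (hI : ∀ s, x < s → s ≤ c → ¬ D.Item s y)
    (h : D.UpC x y k) : ∃ T ∈ D.C, D.UpC x y (D.col T) ∧
      (∀ᶠ t in 𝓝[<] y, D.Reach D.C c t (D.X T) (D.Y T)) ∧
      (¬ D.CVertex D.C x y → ∀ᶠ t in 𝓝[>] y, D.Reach D.C c t (D.X T) (D.Y T)) := by
  obtain ⟨T, hT, h1, h2, h3⟩ := DnC.reach_right (D := D.flipY) (x := x) (c := c) (y := -y) (k := k)
    hc (fun s hs hs' hs'' => hI s hs hs' (by have := item_flipY.1 hs''; rwa [neg_neg] at this))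
    (dnC_flipY.2 (by rwa [neg_neg]))
  rw [dnC_flipY, neg_neg] at h1
  have key : ∀ t, D.flipY.Reach D.flipY.C (D.flipY.X T) (D.flipY.Y T) c (-t) →
      D.Reach D.C c t (D.X T) (D.Y T) := fun t ht => by
    have := Reach.of_flipY (D := D.toMonotoneDrawing) ht
    simpa only [flipY, MonotoneDrawing.flipY, neg_neg] using this
  refine ⟨T, hT, h1, (tendsto_neg_nhdsLT.eventually h2).mono key,
    fun hC => (tendsto_neg_nhdsGT.eventually (h3 ?_)).mono key⟩
  rwa [cvertex_flipY, neg_neg]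

theorem UpC.reach_left (hc : c < x) (hI : ∀ s, c ≤ s → s < x → ¬ D.Item s y)
    (h : D.UpC x y k) : ∃ T ∈ D.C, D.UpC x y (D.col T) ∧
      (∀ᶠ t in 𝓝[<] y, D.Reach D.C c t (D.X T) (D.Y T)) ∧
      (¬ D.CVertex D.C x y → ∀ᶠ t in 𝓝[>] y, D.Reach D.C c t (D.X T) (D.Y T)) := by
  obtain ⟨T, hT, h1, h2, h3⟩ := DnC.reach_left (D := D.flipY) (x := x) (c := c) (y := -y) (k := k)
    hc (fun s hs hs' hs'' => hI s hs hs' (by have := item_flipY.1 hs''; rwa [neg_neg] at this))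
    (dnC_flipY.2 (by rwa [neg_neg]))
  rw [dnC_flipY, neg_neg] at h1
  have key : ∀ t, D.flipY.Reach D.flipY.C (D.flipY.X T) (D.flipY.Y T) c (-t) →
      D.Reach D.C c t (D.X T) (D.Y T) := fun t ht => by
    have := Reach.of_flipY (D := D.toMonotoneDrawing) ht
    simpa only [flipY, MonotoneDrawing.flipY, neg_neg] using this
  refine ⟨T, hT, h1, (tendsto_neg_nhdsLT.eventually h2).mono key,
    fun hC => (tendsto_neg_nhdsGT.eventually (h3 ?_)).mono key⟩
  rwa [cvertex_flipY, neg_neg]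

/-- Going up to `(a, y)`, over to `(b, y)`, and further up. -/
theorem exists_common_of_dnC_upC {a b : ℝ} (hab : a < b)
    (hI : ∀ s, a < s → s < b → ¬ D.Item s y)
    (hC : ¬ D.CVertex D.C a y ∨ ¬ D.CVertex D.C b y) (ha : D.DnC a y k) (hb : D.UpC b y k') :
    ∃ m, D.DnC a y m ∧ D.UpC b y m := by
  obtain ⟨c, hac, hcb⟩ := exists_between hab
  obtain ⟨B, hB, h1, h2, h3⟩ := ha.reach_right hac fun s h h' => hI s h (by linarith)
  obtain ⟨T, hT, h4, h5, h6⟩ := hb.reach_left hcb fun s h h' => hI s (by linarith) h'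
  refine ⟨D.col B, h1, ?_⟩
  have key : ∀ t, D.Reach D.C (D.X B) (D.Y B) c t → D.Reach D.C c t (D.X T) (D.Y T) →
      D.Free D.C c t → D.col B = D.col T :=
    fun t e1 e2 e3 => D.col_reach B hB T hT (e1.trans e3 e2)
  suffices D.col B = D.col T by rwa [this]
  -- The two curves are spliced just below the line if `a` is not in the cover, and just above it if
  -- `b` is not: on that side both are available.
  rcases hC with hC | hC
  · have hf : D.Free D.C c y := free_of_gap ha.item hC (fun s h h' => hI s h (by linarith)) hac le_rfl
    obtain ⟨t, e1, e2, e3⟩ := ((h3 hC).and (h5.and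
      (mem_nhdsWithin_of_mem_nhds (eventually_free hf)))).exists
    exact key t e1 e2 e3
  · have hf : D.Free D.C c y := by
      have : D.flipX.Free D.flipX.C (-c) y := by
        refine free_of_gap (a := -b) (c := -c) (item_flipX.2 ?_) ?_ ?_ (by linarith) le_rfl
        · rw [neg_neg]; exact hb.item
        · exact fun h => hC (by have := cvertex_flipX.1 h; rwa [neg_neg] at this)
        · exact fun s h h' hs => hI (-s) (by linarith) (by linarith) (item_flipX.1 hs)
      have := free_flipX.1 this
      rwa [neg_neg] at this
    obtain ⟨t, e1, e2, e3⟩ := (h2.and ((h6 hC).and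
      (mem_nhdsWithin_of_mem_nhds (eventually_free hf)))).exists
    exact key t e1 e2 e3

theorem exists_common_of_upC_dnC {a b : ℝ} (hab : a < b)
    (hI : ∀ s, a < s → s < b → ¬ D.Item s y)
    (hC : ¬ D.CVertex D.C a y ∨ ¬ D.CVertex D.C b y) (ha : D.UpC a y k) (hb : D.DnC b y k') :
    ∃ m, D.UpC a y m ∧ D.DnC b y m := by
  obtain ⟨m, h1, h2⟩ := exists_common_of_dnC_upC (D := D.flipX) (a := -b) (b := -a) (y := y)
    (k := k') (k' := k) (neg_lt_neg hab)
    (fun s h h' hs => hI (-s) (by linarith) (by linarith) (item_flipX.1 hs))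
    (by rw [cvertex_flipX, cvertex_flipX, neg_neg, neg_neg]; exact hC.symm)
    (dnC_flipX.2 (by rwa [neg_neg])) (upC_flipX.2 (by rwa [neg_neg]))
  rw [dnC_flipX, neg_neg] at h1
  rw [upC_flipX, neg_neg] at h2
  exact ⟨m, h2, h1⟩

/-- Going up to `(x, y)` and further up, passing on the right side. -/
theorem exists_common_of_dnC_upC_self (hC : ¬ D.CVertex D.C x y) (h : D.DnC x y k)
    (h' : D.UpC x y k') : ∃ m, D.DnC x y m ∧ D.UpC x y m := by
  obtain ⟨c, hc, -, hI⟩ := D.exists_gap x y (lt_add_one x)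
  obtain ⟨B, hB, h1, h2, h3⟩ := h.reach_right hc hI
  obtain ⟨T, hT, h4, h5, h6⟩ := h'.reach_right hc hI
  have hf : D.Free D.C c y := free_of_gap h.item hC hI hc le_rfl
  obtain ⟨t, e1, e2, e3⟩ := (h2.and ((h6 hC).and
    (mem_nhdsWithin_of_mem_nhds (eventually_free hf)))).exists
  refine ⟨D.col B, h1, ?_⟩
  rwa [D.col_reach B hB T hT (e1.trans e3 e2)]

end Reaching

/-- Two points of the line at height `y` from which one can go up, and between which there are only
such points, lead to vertices of the same colour. -/
def UpLine (D : ColoredDrawing V ι κ) (y : ℝ) : Prop :=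
  ∀ x₁ x₂ k₁ k₂, x₁ ≤ x₂ → D.UpC x₁ y k₁ → D.UpC x₂ y k₂ →
    (∀ x, x₁ ≤ x → x ≤ x₂ → D.Item x y → ∃ k, D.UpC x y k) → k₁ = k₂

/-- No vertex lies strictly between heights `y` and `h`, so an edge reaching height `h` from below
strictly between the two given edges already ran between them at height `y`. Upward access at `y`
thus carries over to `h`, and `UpLine` applies there. -/
theorem col_top_eq_of_next_level {h : ℝ} (hyh : y < h) (hlev : ∀ v, y < D.Y v → h ≤ D.Y v)
    (hS : D.UpLine h) {i₁ i₂ : ι} (hi₁ : D.top i₁ ∈ D.C) (hb₁ : D.Y (D.bot i₁) ≤ y)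
    (ht₁ : y < D.Y (D.top i₁)) (hi₂ : D.top i₂ ∈ D.C) (hb₂ : D.Y (D.bot i₂) ≤ y)
    (ht₂ : y < D.Y (D.top i₂)) (hle : D.f i₁ h ≤ D.f i₂ h)
    (hno : ∀ x, D.f i₁ y ≤ x → x ≤ D.f i₂ y → ¬ D.CVertex D.C x y)
    (hall : ∀ x, D.f i₁ y ≤ x → x ≤ D.f i₂ y → D.Item x y → ∃ k, D.UpC x y k) :
    D.col (D.top i₁) = D.col (D.top i₂) := by
  have up_at : ∀ i, D.top i ∈ D.C → D.Y (D.bot i) ≤ y → y < D.Y (D.top i) →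
      D.UpC (D.f i h) h (D.col (D.top i)) := by
    intro i h1 h2 h3
    rcases eq_or_lt_of_le (hlev _ h3) with h4 | h4
    · refine Or.inl ⟨D.top i, h1, h4.symm, ?_, rfl⟩
      rw [h4, D.f_top]
    · exact Or.inr ⟨i, h1, h2.trans hyh.le, h4, rfl, rfl⟩
  refine hS _ _ _ _ hle (up_at i₁ hi₁ hb₁ ht₁) (up_at i₂ hi₂ hb₂ ht₂) fun x hx1 hx2 hI => ?_
  by_cases hcv : D.CVertex D.C x h
  · obtain ⟨u, hu, h1, h2⟩ := hcv
    exact ⟨_, Or.inl ⟨u, hu, h1, h2, rfl⟩⟩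
  have of_bot : ∀ j, D.Y (D.bot j) = h → D.X (D.bot j) = x → ∃ k, D.UpC x h k := by
    intro j h1 h2
    have ht := (D.cover j).resolve_left fun hb => hcv ⟨_, hb, h1, h2⟩
    refine ⟨_, Or.inr ⟨j, ht, h1.le, h1 ▸ D.lt j, ?_, rfl⟩⟩
    rw [← h1, D.f_bot, h2]
  have of_lt : ∀ j, D.Y (D.bot j) < h → h ≤ D.Y (D.top j) → D.f j h = x →
      ∃ k, D.UpC x h k := by
    intro j hbj htj hjx
    have hbj : D.Y (D.bot j) ≤ y := by
      by_contra hcon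
      exact absurd (hlev _ (not_le.1 hcon)) (not_le.2 hbj)
    rcases eq_or_lt_of_le hx1 with h1 | h1
    · exact ⟨_, h1 ▸ up_at i₁ hi₁ hb₁ ht₁⟩
    rcases eq_or_lt_of_le hx2 with h2 | h2
    · exact ⟨_, h2 ▸ up_at i₂ hi₂ hb₂ ht₂⟩
    have hyj : D.On j y := ⟨hbj, hyh.le.trans htj⟩
    have hhj : D.On j h := ⟨hbj.trans hyh.le, htj⟩
    have e1 : D.f i₁ y ≤ D.f j y := order (s := h) ⟨hb₁.trans hyh.le, hlev _ ht₁⟩ hhj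
      ⟨hb₁, ht₁.le⟩ hyj (by rwa [hjx])
    have e2 : D.f j y ≤ D.f i₂ y := order (s := h) hhj ⟨hb₂.trans hyh.le, hlev _ ht₂⟩ hyj
      ⟨hb₂, ht₂.le⟩ (by rwa [hjx])
    have htop : D.top j ∈ D.C := by
      -- The upward access at this point may come from another edge `i`. Then `i` and `j` meet in a
      -- vertex outside `C`, which is the lower end of `j`, so `top j` is in the cover.
      obtain ⟨k, ⟨u, hu, h3, h4, -⟩ | ⟨i, hi, h3, h4, h5, -⟩⟩ :=
        hall _ e1 e2 (Or.inr ⟨j, hyj, rfl⟩)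
      · exact absurd ⟨u, hu, h3, h4⟩ (hno _ e1 e2)
      · by_cases hij : j = i
        · rwa [hij]
        obtain ⟨v, rfl, hv⟩ := D.cross j i hij y hyj.1 hyj.2 h3 h4.le h5.symm
        refine (D.cover j).resolve_left fun hb => hno _ e1 e2 ⟨v, ?_, rfl, hv⟩
        rwa [← bot_eq hyj (hyh.trans_le htj) hv.symm]
    exact ⟨_, hjx ▸ up_at j htop hbj (hyh.trans_le htj)⟩
  rcases hI with ⟨v, hv, hvx⟩ | ⟨j, hj, hjx⟩
  · obtain ⟨j, rfl | rfl⟩ := D.covered v fun hvC => hcv ⟨v, hvC, hv, hvx⟩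
    · exact of_bot j hv hvx
    · exact of_lt j (hv ▸ D.lt j) hv.ge (by rw [← hv, D.f_top, hvx])
  · rcases eq_or_lt_of_le hj.1 with h1 | h1
    · refine of_bot j h1 ?_
      rw [← hjx, ← h1, D.f_bot]
    · exact of_lt j h1 hj.2 hjx

theorem eq_of_upC_of_no_cvertex [Finite V] (hS : ∀ v, y < D.Y v → D.UpLine (D.Y v)) {x₁ x₂ : ℝ} {k₁ k₂ : κ}
    (hle : x₁ ≤ x₂) (h₁ : D.UpC x₁ y k₁) (h₂ : D.UpC x₂ y k₂)
    (hno : ∀ x, x₁ ≤ x → x ≤ x₂ → ¬ D.CVertex D.C x y)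
    (hall : ∀ x, x₁ ≤ x → x ≤ x₂ → D.Item x y → ∃ k, D.UpC x y k) : k₁ = k₂ := by
  rcases h₁ with ⟨u, hu, h1, h2, -⟩ | ⟨i₁, a1, a2, a3, rfl, rfl⟩
  · exact absurd ⟨u, hu, h1, h2⟩ (hno x₁ le_rfl hle)
  rcases h₂ with ⟨u, hu, h1, h2, -⟩ | ⟨i₂, b1, b2, b3, rfl, rfl⟩
  · exact absurd ⟨u, hu, h1, h2⟩ (hno x₂ hle le_rfl)
  obtain ⟨v, hv, hmin⟩ := Set.exists_min_image {v | y < D.Y v} D.Y (Set.toFinite _) ⟨_, a3⟩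
  have hv : y < D.Y v := hv
  rcases le_or_gt (D.f i₁ (D.Y v)) (D.f i₂ (D.Y v)) with h | h
  · exact col_top_eq_of_next_level hv hmin (hS v hv) a1 a2 a3 b1 b2 b3 h hno hall
  -- The edges keep their order, so reversed order at the next level forces equal positions at
  -- height `y`, and their roles can be swapped.
  · have e : D.f i₂ y ≤ D.f i₁ y := order (s := D.Y v) ⟨b2.trans hv.le, hmin _ b3⟩
      ⟨a2.trans hv.le, hmin _ a3⟩ ⟨b2, b3.le⟩ ⟨a2, a3.le⟩ h
    exact (col_top_eq_of_next_level hv hmin (hS v hv) b1 b2 b3 a1 a2 a3 h.le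
      (fun x h1 h2 => hno x (hle.trans h1) (h2.trans hle))
      (fun x h1 h2 => hall x (hle.trans h1) (h2.trans hle))).symm

/-- A property that is passed on between consecutive elements of a finite set of reals is passed on
between all elements. -/
theorem of_consecutive {s : Set ℝ} (hs : s.Finite) {P : ℝ → Prop} {a b : ℝ} (ha : a ∈ s)
    (hb : b ∈ s) (hab : a ≤ b) (hP : P a)
    (step : ∀ c ∈ s, ∀ d ∈ s, a ≤ c → c < d → d ≤ b → (∀ e ∈ s, c < e → ¬ e < d) → P c → P d) :
    P b := by
  obtain ⟨c, ⟨hc1, hc2, hc3, hc4⟩, hmax⟩ := Set.exists_max_image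
    {c | c ∈ s ∧ a ≤ c ∧ c ≤ b ∧ P c} id (hs.subset fun _ h => h.1) ⟨a, ha, le_rfl, hab, hP⟩
  rcases eq_or_lt_of_le hc3 with rfl | hlt
  · exact hc4
  obtain ⟨d, ⟨hd1, hd2⟩, hmin⟩ := Set.exists_min_image
    {d | d ∈ s ∧ c < d} id (hs.subset fun _ h => h.1) ⟨b, hb, hlt⟩
  have hdb : d ≤ b := hmin b ⟨hb, hlt⟩
  have := hmax d ⟨hd1, hc2.trans hd2.le, hdb, step c hc1 d hd1 hc2 hd2 hdb
    (fun e he h1 h2 => absurd (hmin e ⟨he, h1⟩) (not_le.2 h2)) hc4⟩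
  exact absurd hd2 (not_lt.2 this)

theorem exists_allC_of_on (i : ι) : ∃ k, ∀ y, D.On i y → D.AllC (D.f i y) y k := by
  by_cases ht : D.top i ∈ D.C
  · refine ⟨D.col (D.top i), fun y hy => Or.inl ?_⟩
    rcases eq_or_lt_of_le hy.2 with rfl | h
    · exact Or.inl ⟨_, ht, rfl, (D.f_top i).symm, rfl⟩
    · exact Or.inr ⟨i, ht, hy.1, h, rfl, rfl⟩
  · have hb := (D.cover i).resolve_right ht
    refine ⟨D.col (D.bot i), fun y hy => Or.inr ?_⟩
    rcases eq_or_lt_of_le hy.1 with rfl | h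
    · exact Or.inl ⟨_, hb, rfl, (D.f_bot i).symm, rfl⟩
    · exact Or.inr ⟨i, hb, h, hy.2, rfl, rfl⟩

theorem exists_allC_of_item {x : ℝ} (h : D.Item x y) : ∃ k, D.AllC x y k := by
  rcases h with ⟨v, rfl, rfl⟩ | ⟨i, hi, rfl⟩
  · by_cases hv : v ∈ D.C
    · exact ⟨D.col v, Or.inl (Or.inl ⟨v, hv, rfl, rfl, rfl⟩)⟩
    obtain ⟨i, hi⟩ := D.covered v hv
    obtain ⟨k, hk⟩ := D.exists_allC_of_on i
    rcases hi with rfl | rfl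
    · have := hk (D.Y (D.bot i)) ⟨le_rfl, (D.lt i).le⟩
      rw [D.f_bot] at this
      exact ⟨k, this⟩
    · have := hk (D.Y (D.top i)) ⟨(D.lt i).le, le_rfl⟩
      rw [D.f_top] at this
      exact ⟨k, this⟩
  · obtain ⟨k, hk⟩ := D.exists_allC_of_on i
    exact ⟨k, hk y hi⟩

variable [Finite V] [Finite ι]

/-- It suffices to find a common upward colour for consecutive points. Two cover vertices are joined
by a rung, a single one sees past its neighbour, and with none the next level decides. A cover
vertex counts as leading down as well, which makes the curve lemmas applicable. -/
theorem upLine_of_above (hS : ∀ v, y < D.Y v → D.UpLine (D.Y v)) : D.UpLine y := by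
  intro x₁ x₂ k₁ k₂ hle h₁ h₂ hall
  have point : ∀ x k k', D.UpC x y k → D.UpC x y k' → k' = k := by
    intro x k k' h h'
    by_cases hcv : D.CVertex D.C x y
    · obtain ⟨u, hu, rfl, rfl⟩ := hcv
      rw [h.eq_col hu, h'.eq_col hu]
    · refine eq_of_upC_of_no_cvertex hS le_rfl h' h (fun z h1 h2 => ?_) fun z h1 h2 _ => ?_
      · rwa [le_antisymm h2 h1]
      · exact ⟨k, le_antisymm h2 h1 ▸ h⟩
  refine (of_consecutive (P := fun x => ∀ k, D.UpC x y k → k = k₁) (D.finite_items y) h₁.item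
    h₂.item hle (fun k h => point _ _ _ h₁ h) ?_ k₂ h₂).symm
  intro a ha b hb ha1 hab hb2 hgap hP
  have hgap : ∀ s, a < s → s < b → ¬ D.Item s y := fun s h h' hs => hgap s hs h h'
  obtain ⟨ka, hka⟩ := hall a ha1 (hab.le.trans hb2) ha
  obtain ⟨kb, hkb⟩ := hall b (ha1.trans hab.le) hb2 hb
  suffices h : ∃ m, D.UpC a y m ∧ D.UpC b y m by
    obtain ⟨m, h1, h2⟩ := h
    exact fun k hk => (point _ _ _ h2 hk).trans (hP m h1)
  by_cases hCa : D.CVertex D.C a y <;> by_cases hCb : D.CVertex D.C b y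
  · obtain ⟨u, hu, hu1, hu2⟩ := hCa
    obtain ⟨w, hw, hw1, hw2⟩ := hCb
    refine ⟨D.col u, Or.inl ⟨u, hu, hu1, hu2, rfl⟩, Or.inl ⟨w, hw, hw1, hw2, ?_⟩⟩
    refine (D.col_rung u hu w hw (hu1.trans hw1.symm) (by rwa [hu2, hw2]) ?_).symm
    rwa [hu1, hu2, hw2]
  · obtain ⟨u, hu, hu1, hu2⟩ := hCa
    obtain ⟨m, h1, h2⟩ := exists_common_of_dnC_upC hab hgap (Or.inr hCb)
      (Or.inl ⟨u, hu, hu1, hu2, rfl⟩) hkb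
    subst hu1 hu2
    exact ⟨m, Or.inl ⟨u, hu, rfl, rfl, (h1.eq_col hu).symm⟩, h2⟩
  · obtain ⟨u, hu, hu1, hu2⟩ := hCb
    obtain ⟨m, h1, h2⟩ := exists_common_of_upC_dnC hab hgap (Or.inl hCa) hka
      (Or.inl ⟨u, hu, hu1, hu2, rfl⟩)
    subst hu1 hu2
    exact ⟨m, h1, Or.inl ⟨u, hu, rfl, rfl, (h2.eq_col hu).symm⟩⟩
  · have hends : ∀ x, a ≤ x → x ≤ b → D.Item x y → x = a ∨ x = b := by
      intro x h1 h2 h3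
      rcases eq_or_lt_of_le h1 with h4 | h4
      · exact Or.inl h4.symm
      rcases eq_or_lt_of_le h2 with h5 | h5
      · exact Or.inr h5
      exact absurd h3 (hgap x h4 h5)
    have := eq_of_upC_of_no_cvertex hS hab.le hka hkb (fun x h1 h2 h3 => ?_) fun x h1 h2 h3 => ?_
    · exact ⟨ka, hka, this ▸ hkb⟩
    · obtain ⟨u, hu, hu1, hu2⟩ := id h3
      rcases hends x h1 h2 (Or.inl ⟨u, hu1, hu2⟩) with rfl | rfl
      · exact hCa h3
      · exact hCb h3
    · rcases hends x h1 h2 h3 with rfl | rfl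
      · exact ⟨_, hka⟩
      · exact ⟨_, hkb⟩

theorem upLine (D : ColoredDrawing V ι κ) (y : ℝ) : D.UpLine y := by
  induction hn : {v | y < D.Y v}.ncard using Nat.strong_induction_on generalizing y with
  | _ n ih =>
    refine upLine_of_above fun v hv => ih _ ?_ (D.Y v) rfl
    rw [← hn]
    exact Set.ncard_lt_ncard ⟨fun w hw => lt_trans hv hw, fun h => lt_irrefl (D.Y v) (h hv)⟩
      (Set.toFinite _)

/-- Two upward colours agree by `upLine`, two downward ones by reflection, and outside the cover a
curve passing beside the point links the two kinds. -/
theorem eq_of_allC {x : ℝ} (h : D.AllC x y k) (h' : D.AllC x y k') : k = k' := by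
  by_cases hcv : D.CVertex D.C x y
  · obtain ⟨u, hu, rfl, rfl⟩ := hcv
    have key : ∀ k, D.AllC (D.X u) (D.Y u) k → k = D.col u :=
      fun k h => h.elim (fun h => h.eq_col hu) fun h => h.eq_col hu
    rw [key k h, key k' h']
  have up : ∀ k k', D.UpC x y k → D.UpC x y k' → k = k' := fun k k' h h' =>
    D.upLine y x x k k' le_rfl h h' fun z h1 h2 _ => ⟨k, le_antisymm h1 h2 ▸ h⟩
  have dn : ∀ k k', D.DnC x y k → D.DnC x y k' → k = k' := fun k k' h h' => by
    refine D.flipY.upLine (-y) x x k k' le_rfl (upC_flipY.2 ?_) (upC_flipY.2 ?_)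
      fun z h1 h2 _ => ⟨k, upC_flipY.2 ?_⟩
    · rwa [neg_neg]
    · rwa [neg_neg]
    · rw [neg_neg]
      exact le_antisymm h1 h2 ▸ h
  have mixed : ∀ k k', D.DnC x y k → D.UpC x y k' → k = k' := fun k k' h h' => by
    obtain ⟨m, h1, h2⟩ := exists_common_of_dnC_upC_self hcv h h'
    exact (dn _ _ h h1).trans (up _ _ h2 h')
  rcases h with h | h <;> rcases h' with h' | h'
  · exact up _ _ h h'
  · exact (mixed _ _ h' h).symm
  · exact mixed _ _ h h'
  · exact dn _ _ h h'

/-- If the points share no direction, neither is in the cover, as cover vertices lead both ways. A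
curve through the gap then links the two directions. -/
theorem exists_common_allC {a b : ℝ} (hab : a < b) (ha : D.Item a y) (hb : D.Item b y)
    (hgap : ∀ s, a < s → s < b → ¬ D.Item s y) : ∃ m, D.AllC a y m ∧ D.AllC b y m := by
  have hends : ∀ x, a ≤ x → x ≤ b → D.Item x y → x = a ∨ x = b := by
    intro x h1 h2 h3
    rcases eq_or_lt_of_le h1 with h4 | h4
    · exact Or.inl h4.symm
    rcases eq_or_lt_of_le h2 with h5 | h5
    · exact Or.inr h5
    exact absurd h3 (hgap x h4 h5)
  have cv : ∀ x, D.CVertex D.C x y → (∃ k, D.UpC x y k) ∧ ∃ k, D.DnC x y k := by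
    rintro x ⟨u, hu, h1, h2⟩
    exact ⟨⟨_, Or.inl ⟨u, hu, h1, h2, rfl⟩⟩, ⟨_, Or.inl ⟨u, hu, h1, h2, rfl⟩⟩⟩
  by_cases hu : (∃ k, D.UpC a y k) ∧ ∃ k, D.UpC b y k
  · obtain ⟨⟨ka, hka⟩, kb, hkb⟩ := hu
    have := D.upLine y a b ka kb hab.le hka hkb fun x h1 h2 h3 => by
      rcases hends x h1 h2 h3 with rfl | rfl
      · exact ⟨_, hka⟩
      · exact ⟨_, hkb⟩
    exact ⟨ka, Or.inl hka, Or.inl (this ▸ hkb)⟩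
  by_cases hd : (∃ k, D.DnC a y k) ∧ ∃ k, D.DnC b y k
  · obtain ⟨⟨ka, hka⟩, kb, hkb⟩ := hd
    have flip : ∀ {x k}, D.DnC x y k → D.flipY.UpC x (-y) k := fun h =>
      upC_flipY.2 (by rwa [neg_neg])
    have := D.flipY.upLine (-y) a b ka kb hab.le (flip hka) (flip hkb) fun x h1 h2 h3 => by
      have h3 := item_flipY.1 h3
      rw [neg_neg] at h3
      rcases hends x h1 h2 h3 with rfl | rfl
      · exact ⟨_, flip hka⟩
      · exact ⟨_, flip hkb⟩
    exact ⟨ka, Or.inr hka, Or.inr (this ▸ hkb)⟩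
  obtain ⟨ka, hka⟩ := exists_allC_of_item ha
  obtain ⟨kb, hkb⟩ := exists_allC_of_item hb
  rcases hka with hka | hka <;> rcases hkb with hkb | hkb
  · exact absurd ⟨⟨_, hka⟩, _, hkb⟩ hu
  · obtain ⟨m, h1, h2⟩ := exists_common_of_upC_dnC hab hgap
      (Or.inl fun h => hd ⟨(cv a h).2, _, hkb⟩) hka hkb
    exact ⟨m, Or.inl h1, Or.inr h2⟩
  · obtain ⟨m, h1, h2⟩ := exists_common_of_dnC_upC hab hgap
      (Or.inl fun h => hu ⟨(cv a h).1, _, hkb⟩) hka hkb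
    exact ⟨m, Or.inr h1, Or.inl h2⟩
  · exact absurd ⟨⟨_, hka⟩, _, hkb⟩ hd

/-- All points of the drawing on a horizontal line lead to vertices of the same colour. -/
theorem eq_of_allC_line {x₁ x₂ : ℝ} (h : D.AllC x₁ y k) (h' : D.AllC x₂ y k') : k = k' := by
  have item : ∀ {x k}, D.AllC x y k → D.Item x y := fun h =>
    h.elim (fun h => h.item) fun h => h.item
  have key : ∀ {x₁ x₂ k k'}, x₁ ≤ x₂ → D.AllC x₁ y k → D.AllC x₂ y k' → k' = k := by
    intro x₁ x₂ k k' hle h h'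
    refine of_consecutive (P := fun x => ∀ k', D.AllC x y k' → k' = k) (D.finite_items y)
      (item h) (item h') hle (fun _ h1 => eq_of_allC h1 h) ?_ k' h'
    intro a ha b hb _ hab _ hgap hP m' hm'
    obtain ⟨m, h1, h2⟩ := exists_common_allC hab ha hb fun s h h' hs => hgap s hs h h'
    exact (eq_of_allC hm' h2).trans (hP m h1)
  rcases le_total x₁ x₂ with hle | hle
  · exact (key hle h h').symm
  · exact key hle h' h

/-- An edge spanning both levels carries its own colour. Without one, the strip between the levels
is empty: the rightmost point below leads down, the rightmost point above leads up, and a curve to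
the right of both connects them. -/
theorem exists_common_of_levels {a b : ℝ} (hab : a < b) (ha : a ∈ Set.range D.Y)
    (hb : b ∈ Set.range D.Y) (hgap : ∀ v, a < D.Y v → ¬ D.Y v < b) :
    ∃ x x' m, D.AllC x a m ∧ D.AllC x' b m := by
  by_cases hon : ∃ i, D.On i a ∧ D.On i b
  · obtain ⟨i, h1, h2⟩ := hon
    obtain ⟨k, hk⟩ := D.exists_allC_of_on i
    exact ⟨_, _, k, hk a h1, hk b h2⟩
  obtain ⟨va, rfl⟩ := ha
  obtain ⟨vb, rfl⟩ := hb
  obtain ⟨xa, hxa, hmaxa⟩ := Set.exists_max_image _ id (D.finite_items (D.Y va)) ⟨_, item_vertex va⟩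
  obtain ⟨xb, hxb, hmaxb⟩ := Set.exists_max_image _ id (D.finite_items (D.Y vb)) ⟨_, item_vertex vb⟩
  have below : ∀ i, D.Y (D.bot i) < D.Y vb → D.Y (D.bot i) ≤ D.Y va := fun i h => by
    by_contra hcon
    exact hgap _ (not_le.1 hcon) h
  have above : ∀ i, D.Y va < D.Y (D.top i) → D.Y vb ≤ D.Y (D.top i) := fun i h => by
    by_contra hcon
    exact hgap _ h (not_le.1 hcon)
  obtain ⟨ka, hka⟩ : ∃ k, D.DnC xa (D.Y va) k := by
    obtain ⟨k, (⟨u, hu⟩ | ⟨i, h0, h1, h2, -⟩) | h⟩ := exists_allC_of_item hxa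
    · exact ⟨k, Or.inl ⟨u, hu⟩⟩
    · exact absurd ⟨i, ⟨h1, h2.le⟩, ⟨h1.trans hab.le, above i h2⟩⟩ hon
    · exact ⟨k, h⟩
  obtain ⟨kb, hkb⟩ : ∃ k, D.UpC xb (D.Y vb) k := by
    obtain ⟨k, h | ⟨u, hu⟩ | ⟨i, h0, h1, h2, -⟩⟩ := exists_allC_of_item hxb
    · exact ⟨k, h⟩
    · exact ⟨k, Or.inl ⟨u, hu⟩⟩
    · exact absurd ⟨i, ⟨below i h1, hab.le.trans h2⟩, ⟨h1.le, h2⟩⟩ hon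
  obtain ⟨c, hca, hcb⟩ : ∃ c, xa < c ∧ xb < c :=
    ⟨max xa xb + 1, (le_max_left _ _).trans_lt (lt_add_one _),
      (le_max_right _ _).trans_lt (lt_add_one _)⟩
  obtain ⟨B, hB, h1, h2, -⟩ := hka.reach_right hca fun s h _ hs => absurd (hmaxa s hs) (not_le.2 h)
  obtain ⟨T, hT, h3, h4, -⟩ := hkb.reach_right hcb fun s h _ hs => absurd (hmaxb s hs) (not_le.2 h)
  obtain ⟨t₁, e1, e2⟩ := (h2.and (Ioo_mem_nhdsGT hab)).exists
  obtain ⟨t₂, e3, e4⟩ := (h4.and (Ioo_mem_nhdsLT e2.2)).exists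
  have hfree : ∀ s, D.Y va < s → s < D.Y vb → D.Free D.C c s := fun s hs hs' =>
    free_of_generic (fun v hv => hgap v (by rwa [hv]) (by rwa [hv])) fun i hi _ => hon
      ⟨i, ⟨below i (hi.1.trans_lt hs'), hs.le.trans hi.2⟩,
        ⟨hi.1.trans hs'.le, above i (hs.trans_le hi.2)⟩⟩
  have hcol : D.col B = D.col T := D.col_reach B hB T hT
    ((e1.trans (hfree _ e2.1 e2.2) (reach_vertical e4.1 fun s hs hs' =>
      hfree s (e2.1.trans hs) (hs'.trans e4.2))).trans (hfree _ (e2.1.trans e4.1) e4.2) e3)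
  exact ⟨xa, xb, D.col B, Or.inr h1, Or.inl (hcol ▸ h3)⟩

/-- All vertices of the cover have the same colour. -/
theorem col_eq (D : ColoredDrawing V ι κ) {u w : V} (hu : u ∈ D.C) (hw : w ∈ D.C) :
    D.col u = D.col w := by
  have self : ∀ {u}, u ∈ D.C → D.AllC (D.X u) (D.Y u) (D.col u) := fun {u} hu =>
    Or.inl (Or.inl ⟨u, hu, rfl, rfl, rfl⟩)
  have key : ∀ {u w}, u ∈ D.C → w ∈ D.C → D.Y u ≤ D.Y w → D.col w = D.col u := by
    intro u w hu hw hle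
    refine of_consecutive (P := fun y => ∀ x k, D.AllC x y k → k = D.col u)
      (Set.finite_range D.Y) ⟨u, rfl⟩ ⟨w, rfl⟩ hle (fun x k h => eq_of_allC_line h (self hu)) ?_
      _ _ (self hw)
    intro a ha b hb _ hab _ hgap hP x k hk
    obtain ⟨x₁, x₂, m, h1, h2⟩ := D.exists_common_of_levels hab ha hb
      fun v h h' => hgap _ ⟨v, rfl⟩ h h'
    exact (eq_of_allC_line hk h2).trans (hP _ _ h1)
  rcases le_total (D.Y u) (D.Y w) with h | h
  · exact (key hu hw h).symm
  · exact key hw hu h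

end ColoredDrawing

end LevelPlanarity

/-! ### From visibility extensions to monotone drawings -/

namespace LevelPlanarity

open Filter Topology

theorem IsYMonotoneCurve.exists_continuous {p q : ℝ × ℝ} {K : Set (ℝ × ℝ)}
    (h : IsYMonotoneCurve p q K) : ∃ f : ℝ → ℝ, Continuous f ∧ f p.2 = p.1 ∧ f q.2 = q.1 ∧
      ∀ r : ℝ × ℝ, r ∈ K ↔ (p.2 ≤ r.2 ∧ r.2 ≤ q.2) ∧ f r.2 = r.1 := by
  obtain ⟨hlt, f, hf, hp, hq, rfl⟩ := h
  have hval : ∀ t ∈ Set.Icc p.2 q.2,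
      Set.IccExtend hlt.le ((Set.Icc p.2 q.2).domRestrict f) t = f t :=
    fun t ht => Set.IccExtend_of_mem _ _ ht
  refine ⟨Set.IccExtend hlt.le ((Set.Icc p.2 q.2).domRestrict f),
    (continuousOn_iff_continuous_domRestrict.1 hf).Icc_extend',
    (hval _ (Set.left_mem_Icc.2 hlt.le)).trans hp, (hval _ (Set.right_mem_Icc.2 hlt.le)).trans hq,
    fun r => ⟨?_, ?_⟩⟩
  · rintro ⟨t, ht, rfl⟩
    exact ⟨ht, hval t ht⟩
  · rintro ⟨hr, h⟩
    exact ⟨r.2, hr, Prod.ext ((hval _ hr).symm.trans h) rfl⟩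

theorem DrawnEdge.NonCrossing.symm {V : Type*} {pos : V → ℝ × ℝ} {e f : DrawnEdge V}
    (h : e.NonCrossing pos f) : f.NonCrossing pos e := by
  unfold DrawnEdge.NonCrossing at *
  rwa [Set.inter_comm, Set.inter_comm f.ends]

/-- A family of y-monotone edges that can be drawn together. -/
structure IsMonotoneFamily {V : Type*} (pos : V → ℝ × ℝ) (F : Set (DrawnEdge V)) : Prop where
  injective : Function.Injective pos
  mono : ∀ e ∈ F, IsYMonotoneCurve (pos e.tail) (pos e.head) e.curve
  avoids : ∀ e ∈ F, e.AvoidsVertices pos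
  nonCrossing : ∀ e ∈ F, ∀ f ∈ F, e ≠ f → e.NonCrossing pos f

namespace IsMonotoneFamily

variable {V : Type*} {pos : V → ℝ × ℝ} {F : Set (DrawnEdge V)}

noncomputable def fn (h : IsMonotoneFamily pos F) (e : F) : ℝ → ℝ :=
  (h.mono e e.2).exists_continuous.choose

theorem mem_curve_iff (h : IsMonotoneFamily pos F) (e : F) (r : ℝ × ℝ) :
    r ∈ e.1.curve ↔ ((pos e.1.tail).2 ≤ r.2 ∧ r.2 ≤ (pos e.1.head).2) ∧ h.fn e r.2 = r.1 :=
  (h.mono e e.2).exists_continuous.choose_spec.2.2.2 r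

noncomputable def drawing (h : IsMonotoneFamily pos F) : MonotoneDrawing V F where
  X v := (pos v).1
  Y v := (pos v).2
  bot e := e.1.tail
  top e := e.1.head
  f := h.fn
  lt e := (h.mono e e.2).1
  cont e := (h.mono e e.2).exists_continuous.choose_spec.1
  f_bot e := (h.mono e e.2).exists_continuous.choose_spec.2.1
  f_top e := (h.mono e e.2).exists_continuous.choose_spec.2.2.1
  inj u v h1 h2 := h.injective (Prod.ext h1 h2)
  avoid e v h1 h2 h3 := h.avoids e e.2 v ((h.mem_curve_iff e _).2 ⟨⟨h1, h2⟩, h3⟩)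
  cross e e' hne t h1 h2 h3 h4 h5 := by
    obtain ⟨v, -, hv⟩ := h.nonCrossing e e.2 e' e'.2 (fun he => hne (Subtype.ext he))
      ⟨(h.mem_curve_iff e (h.fn e t, t)).2 ⟨⟨h1, h2⟩, rfl⟩,
        (h.mem_curve_iff e' (h.fn e t, t)).2 ⟨⟨h3, h4⟩, h5.symm⟩⟩
    exact ⟨v, by rw [hv], by rw [hv]⟩

theorem item_of_mem_curve (h : IsMonotoneFamily pos F) {e : DrawnEdge V} (he : e ∈ F) {r : ℝ × ℝ}
    (hr : r ∈ e.curve) : h.drawing.Item r.1 r.2 :=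
  Or.inr ⟨⟨e, he⟩, (h.mem_curve_iff ⟨e, he⟩ r).1 hr⟩

end IsMonotoneFamily

/-- Only points between two curves with common endpoints lie in the interior of their union. -/
theorem between_of_mem_curveInterior {f g : ℝ → ℝ} {a b : ℝ} {K : Set (ℝ × ℝ)}
    (ha : f a = g a) (hb : f b = g b)
    (hK : ∀ r : ℝ × ℝ, r ∈ K ↔ (a ≤ r.2 ∧ r.2 ≤ b) ∧ (f r.2 = r.1 ∨ g r.2 = r.1)) {p : ℝ × ℝ}
    (hp : p ∈ curveInterior K) :
    a < p.2 ∧ p.2 < b ∧ (f p.2 < p.1 ∧ p.1 < g p.2 ∨ g p.2 < p.1 ∧ p.1 < f p.2) := by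
  obtain ⟨hpK, hbd⟩ := hp
  -- A horizontal ray from `p` missing `K` would make the component of `p` unbounded; so `K` is hit
  -- on both sides.
  have ray : ∀ I : Set ℝ, I.OrdConnected → p.1 ∈ I → ¬ Bornology.IsBounded I →
      ∃ s ∈ I, (s, p.2) ∈ K := by
    intro I hI hpI hunb
    by_contra hcon
    push Not at hcon
    have hconn : IsPreconnected ((fun s : ℝ => (s, p.2)) '' I) :=
      hI.isPreconnected.image _ (by fun_prop)
    have hsub := hconn.subset_connectedComponentIn (F := Kᶜ) (x := p) ⟨p.1, hpI, rfl⟩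
      (by rintro _ ⟨s, hs, rfl⟩; exact hcon s hs)
    refine hunb ?_
    have := LipschitzWith.prod_fst.isBounded_image (hbd.subset hsub)
    rwa [Set.image_image, Set.image_id'] at this
  have hright := ray (Set.Ici p.1) Set.ordConnected_Ici Set.self_mem_Ici
    fun h => not_bddAbove_Ici _ h.bddAbove
  have hleft := ray (Set.Iic p.1) Set.ordConnected_Iic Set.self_mem_Iic
    fun h => not_bddBelow_Iic _ h.bddBelow
  obtain ⟨s, hs, hsK⟩ := hright
  obtain ⟨s', hs', hsK'⟩ := hleft
  have hs : p.1 ≤ s := hs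
  have hs' : s' ≤ p.1 := hs'
  rw [hK] at hpK hsK hsK'
  simp only at hsK hsK'
  obtain ⟨hab, h1⟩ := hsK
  obtain ⟨-, h2⟩ := hsK'
  have hf : f p.2 ≠ p.1 := fun h => hpK ⟨hab, Or.inl h⟩
  have hg : g p.2 ≠ p.1 := fun h => hpK ⟨hab, Or.inr h⟩
  have key : f p.2 < p.1 ∧ p.1 < g p.2 ∨ g p.2 < p.1 ∧ p.1 < f p.2 := by
    rcases lt_or_gt_of_ne hf with h3 | h3 <;> rcases lt_or_gt_of_ne hg with h4 | h4
    · rcases h1 with h1 | h1 <;> linarith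
    · exact Or.inl ⟨h3, h4⟩
    · exact Or.inr ⟨h4, h3⟩
    · rcases h2 with h2 | h2 <;> linarith
  refine ⟨lt_of_le_of_ne hab.1 fun h => ?_, lt_of_le_of_ne hab.2 fun h => ?_, key⟩
  · rw [← h, ha] at key
    rcases key with ⟨h3, h4⟩ | ⟨h3, h4⟩ <;> linarith
  · rw [h, hb] at key
    rcases key with ⟨h3, h4⟩ | ⟨h3, h4⟩ <;> linarith

theorem mem_horizontal_segment_iff {A B p : ℝ × ℝ} (h2 : A.2 = B.2) (h1 : A.1 < B.1) :
    p ∈ segment ℝ A B ↔ p.2 = A.2 ∧ A.1 ≤ p.1 ∧ p.1 ≤ B.1 := by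
  have h0 : 0 < B.1 - A.1 := sub_pos.2 h1
  constructor
  · rintro ⟨a, b, ha, hb, hab, rfl⟩
    obtain rfl : a = 1 - b := by linarith
    simp only [Prod.fst_add, Prod.snd_add, Prod.smul_fst, Prod.smul_snd, smul_eq_mul]
    refine ⟨by rw [h2]; ring, by nlinarith, by nlinarith⟩
  · rintro ⟨hp2, hp1, hp1'⟩
    refine ⟨(B.1 - p.1) / (B.1 - A.1), (p.1 - A.1) / (B.1 - A.1),
      div_nonneg (by linarith) h0.le, div_nonneg (by linarith) h0.le, ?_, ?_⟩
    · rw [← add_div, div_eq_one_iff_eq h0.ne']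
      ring
    · refine Prod.ext ?_ ?_
      · simp only [Prod.fst_add, Prod.smul_fst, smul_eq_mul]
        field_simp
        ring
      · simp only [Prod.snd_add, Prod.smul_snd, smul_eq_mul, ← h2]
        rw [hp2, ← add_mul, ← add_div, show B.1 - p.1 + (p.1 - A.1) = B.1 - A.1 by ring,
          div_self h0.ne', one_mul]

namespace VisibilityExtension

variable {V : Type*} {𝒢 : LevelGraph V} {Γ : LevelPlanarDrawing 𝒢} {C : Set V}
  (Λ : VisibilityExtension Γ C)

/-- The y-monotone edges of the visibility extension. -/
def monotoneEdges : Set (DrawnEdge V) :=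
  {e ∈ Λ.edges | IsYMonotoneCurve (Γ.pos e.tail) (Γ.pos e.head) e.curve}

variable {Λ}

theorem mem_monotoneEdges_of_mem {e : DrawnEdge V} (he : e ∈ Γ.edges) : e ∈ Λ.monotoneEdges :=
  ⟨Or.inl he, by rw [he.2]; exact Γ.curve_yMonotone _ _ he.1⟩

theorem monotone_or_segment {e : DrawnEdge V} (he : e ∈ Λ.edges) :
    e ∈ Λ.monotoneEdges ∨ (e ∈ Λ.added ∧ Γ.IsLevelSegment e) := by
  rcases he with he | he
  · exact Or.inl (mem_monotoneEdges_of_mem he)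
  · exact (Λ.maximal.1.1 e he).1.1.imp (fun h => ⟨Or.inr he, h⟩) fun h => ⟨he, h⟩

theorem avoids {e : DrawnEdge V} (he : e ∈ Λ.edges) : e.AvoidsVertices Γ.pos := by
  rcases he with he | he
  · have := Γ.curve_avoids _ _ he.1
    rwa [← he.2] at this
  · exact (Λ.maximal.1.1 e he).1.2.1

theorem eq_of_mem_edges {e f : DrawnEdge V} (he : e ∈ Γ.edges) (hf : f ∈ Γ.edges)
    (ht : e.tail = f.tail) (hh : e.head = f.head) : e = f := by
  have h : e.curve = f.curve := by rw [he.2, hf.2, ht, hh]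
  cases e
  cases f
  simp only at ht hh h
  rw [ht, hh, h]

theorem eq_of_segments {e f : DrawnEdge V} (he : Γ.IsLevelSegment e) (hf : Γ.IsLevelSegment f)
    (h : e.tail = f.tail) : e = f := by
  obtain ⟨a, b, K⟩ := e
  obtain ⟨a', b', K'⟩ := f
  obtain rfl : a = a' := h
  obtain ⟨e1, e2, e3, e4⟩ := he
  obtain ⟨f1, f2, f3, f4⟩ := hf
  simp only at *
  have hbb : b = b' := by
    refine Γ.pos_injective (Prod.ext ?_ ?_)
    · rcases lt_trichotomy (Γ.pos b).1 (Γ.pos b').1 with h | h | h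
      · exact absurd ⟨e2, h⟩ (f3 b e1.symm)
      · exact h
      · exact absurd ⟨f2, h⟩ (e3 b' f1.symm)
    · rw [Γ.pos_level, Γ.pos_level, ← e1, ← f1]
  subst hbb
  rw [e4, f4]

theorem nonCrossing {e f : DrawnEdge V} (he : e ∈ Λ.edges) (hf : f ∈ Λ.edges) (hne : e ≠ f) :
    e.NonCrossing Γ.pos f := by
  rcases he with he | he <;> rcases hf with hf | hf
  · have := Γ.curve_nonCrossing _ _ _ _ he.1 hf.1 fun h => hne ?_
    · rwa [← he.2, ← hf.2] at this
    · obtain ⟨h1, h2⟩ := Prod.mk.inj h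
      exact eq_of_mem_edges he hf h1 h2
  · exact ((Λ.maximal.1.1 f hf).1.2.2 e he).symm
  · exact (Λ.maximal.1.1 e he).1.2.2 f hf
  · exact Λ.maximal.1.2.1 e he f hf hne

theorem isMonotoneFamily {F : Set (DrawnEdge V)} (hF : F ⊆ Λ.monotoneEdges) :
    IsMonotoneFamily Γ.pos F where
  injective := Γ.pos_injective
  mono _ he := (hF he).2
  avoids _ he := avoids (hF he).1
  nonCrossing _ he _ hf hne := nonCrossing (hF he).1 (hF hf).1 hne

/-! ### The edge bound for visibility extensions -/

section Counting

variable [Finite V]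

theorem ncard_le_of_finite {F : Set (DrawnEdge V)} (hF : F ⊆ Λ.monotoneEdges) (hfin : F.Finite)
    (hC : ∀ e ∈ F, e.tail ∈ C ∧ e.head ∈ C) : F.ncard ≤ 3 * C.ncard := by
  have := hfin.to_subtype
  set h := isMonotoneFamily hF
  rw [← Nat.card_coe_set_eq F]
  refine h.drawing.card_edges_le C (fun e => hC e e.2) fun i j hij hb ht => ?_
  have hb : i.1.tail = j.1.tail := hb
  have ht : i.1.head = j.1.head := ht
  obtain ⟨w, hw, hint⟩ := Λ.maximal.1.2.2 i (hF i.2).1 j (hF j.2).1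
    ⟨fun he => hij (Subtype.ext he), by unfold DrawnEdge.ends; rw [hb, ht]⟩
  refine ⟨w, hw, ?_⟩
  have := between_of_mem_curveInterior (f := h.fn i) (g := h.fn j) (a := (Γ.pos i.1.tail).2)
    (b := (Γ.pos i.1.head).2) ?_ ?_ ?_ hint
  · exact this
  · have h2 : h.fn j (Γ.pos j.1.tail).2 = (Γ.pos j.1.tail).1 := h.drawing.f_bot j
    rw [← hb] at h2
    exact (h.drawing.f_bot i).trans h2.symm
  · have h2 : h.fn j (Γ.pos j.1.head).2 = (Γ.pos j.1.head).1 := h.drawing.f_top j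
    rw [← ht] at h2
    exact (h.drawing.f_top i).trans h2.symm
  · intro r
    rw [Set.mem_union, h.mem_curve_iff, h.mem_curve_iff, ← hb, ← ht, ← and_or_left]

/-- The inserted set is not known to be finite beforehand; an infinite one would contain a finite
subfamily exceeding the bound. -/
theorem finite_monotone :
    {e ∈ Λ.monotoneEdges | e.tail ∈ C ∧ e.head ∈ C}.Finite ∧
      {e ∈ Λ.monotoneEdges | e.tail ∈ C ∧ e.head ∈ C}.ncard ≤ 3 * C.ncard := by
  have hfin : {e ∈ Λ.monotoneEdges | e.tail ∈ C ∧ e.head ∈ C}.Finite := by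
    by_contra hinf
    obtain ⟨F, hF, hfin, hcard⟩ :=
      Set.Infinite.exists_subset_ncard_eq hinf (3 * C.ncard + 1)
    have := ncard_le_of_finite (fun e he => (hF he).1) hfin fun e he => (hF he).2
    omega
  exact ⟨hfin, ncard_le_of_finite (fun e he => he.1) hfin fun e he => he.2⟩

theorem finite_segments :
    {e ∈ Λ.added | Γ.IsLevelSegment e}.Finite ∧
      {e ∈ Λ.added | Γ.IsLevelSegment e}.ncard ≤ C.ncard := by
  have hmaps : ∀ e ∈ {e ∈ Λ.added | Γ.IsLevelSegment e}, e.tail ∈ C :=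
    fun e he => (Λ.maximal.1.1 e he.1).2.1
  have hinj : Set.InjOn DrawnEdge.tail {e ∈ Λ.added | Γ.IsLevelSegment e} :=
    fun e he f hf h => eq_of_segments he.2 hf.2 h
  exact ⟨Set.Finite.of_injOn hmaps hinj (Set.toFinite C),
    Set.ncard_le_ncard_of_injOn _ hmaps hinj (Set.toFinite C)⟩

theorem finite_inducedEdges :
    (Λ.inducedEdges C).Finite ∧ (Λ.inducedEdges C).ncard ≤ 4 * C.ncard := by
  obtain ⟨h1, h2⟩ := Λ.finite_monotone
  obtain ⟨h3, h4⟩ := Λ.finite_segments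
  have hsub : Λ.inducedEdges C ⊆ {e ∈ Λ.monotoneEdges | e.tail ∈ C ∧ e.head ∈ C} ∪
      {e ∈ Λ.added | Γ.IsLevelSegment e} :=
    fun e he => (monotone_or_segment he.1).imp (fun h => ⟨h, he.2⟩) id
  refine ⟨(h1.union h3).subset hsub, ?_⟩
  have h5 := Set.ncard_le_ncard hsub (h1.union h3)
  have h6 := Set.ncard_union_le {e ∈ Λ.monotoneEdges | e.tail ∈ C ∧ e.head ∈ C}
    {e ∈ Λ.added | Γ.IsLevelSegment e}
  omega

theorem finite_monotoneEdges : Λ.monotoneEdges.Finite := by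
  have h1 : Γ.edges.Finite := by
    refine Set.Finite.of_injOn (f := fun e : DrawnEdge V => (e.tail, e.head)) (t := Set.univ)
      (fun _ _ => Set.mem_univ _) ?_ Set.finite_univ
    intro e he f hf h
    obtain ⟨h1, h2⟩ := Prod.mk.inj h
    exact eq_of_mem_edges he hf h1 h2
  refine (h1.union Λ.finite_inducedEdges.1).subset ?_
  rintro e ⟨he | he, -⟩
  · exact Or.inl he
  · exact Or.inr ⟨Or.inr he, (Λ.maximal.1.1 e he).2⟩

end Counting

/-! ### Connectivity from maximality -/

section Connectivity

theorem ne_of_mem_edges {e : DrawnEdge V} (he : e ∈ Λ.edges) : e.tail ≠ e.head := by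
  intro h
  rcases monotone_or_segment he with h1 | ⟨-, h1⟩
  · exact (h ▸ h1.2.1).ne rfl
  · exact (h ▸ h1.2.1).ne rfl

theorem adj_of_mem {e : DrawnEdge V} (he : e ∈ Λ.edges) (ht : e.tail ∈ C) (hh : e.head ∈ C) :
    (Λ.inducedGraph C).Adj ⟨e.tail, ht⟩ ⟨e.head, hh⟩ :=
  ⟨fun h => ne_of_mem_edges he (congrArg Subtype.val h), e, ⟨he, ht, hh⟩, rfl⟩

/-- By maximality, a visibility edge between vertices of `C` that crosses no inserted edge has
adjacent endpoints. -/
theorem adj_of_visible {e : DrawnEdge V} (ht : e.tail ∈ C) (hh : e.head ∈ C)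
    (hvis : Γ.IsVisibilityEdge e) (hcr : ∀ f ∈ Λ.added, e ≠ f → e.NonCrossing Γ.pos f) :
    (Λ.inducedGraph C).Adj ⟨e.tail, ht⟩ ⟨e.head, hh⟩ := by
  have hne : e.tail ≠ e.head := by
    intro h
    rcases hvis.1 with h1 | h1
    · exact (h ▸ h1.1).ne rfl
    · exact (h ▸ h1.2.1).ne rfl
  -- An existing edge with these ends already gives adjacency. Without one, inserting `e` creates no
  -- parallel pair, contradicting maximality.
  by_cases hpar : ∃ f ∈ Λ.edges, f.ends = e.ends
  · obtain ⟨f, hf, hfe⟩ := hpar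
    have hsub : ∀ v ∈ f.ends, v ∈ C := by
      rw [hfe]
      rintro v (rfl | rfl)
      · exact ht
      · exact hh
    exact ⟨fun h => hne (congrArg Subtype.val h), f,
      ⟨hf, hsub _ (Or.inl rfl), hsub _ (Or.inr rfl)⟩, hfe⟩
  push Not at hpar
  have hset : Γ.IsVisibilitySet C (insert e Λ.added) := by
    refine ⟨?_, ?_, ?_⟩
    · rintro f (rfl | hf)
      · exact ⟨hvis, ht, hh⟩
      · exact Λ.maximal.1.1 f hf
    · rintro f (rfl | hf) f' (rfl | hf') hff
      · exact absurd rfl hff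
      · exact hcr f' hf' hff
      · exact (hcr f hf hff.symm).symm
      · exact Λ.maximal.1.2.1 f hf f' hf' hff
    · have cases : ∀ f ∈ Γ.edges ∪ insert e Λ.added, f = e ∨ f ∈ Λ.edges := by
        rintro f (hf | rfl | hf)
        · exact Or.inr (Or.inl hf)
        · exact Or.inl rfl
        · exact Or.inr (Or.inr hf)
      intro f hf f' hf' hff
      rcases cases f hf with h1 | h1 <;> rcases cases f' hf' with h2 | h2
      · exact absurd (h1.trans h2.symm) hff.1
      · exact absurd (h1 ▸ hff.2.symm) (hpar f' h2)
      · exact absurd (h2 ▸ hff.2) (hpar f h1)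
      · exact Λ.maximal.1.2.2 f h1 f' h2 hff
  have hmem : e ∈ Λ.added := Λ.maximal.2 hset (Set.subset_insert _ _) (Set.mem_insert _ _)
  exact absurd rfl (hpar e (Or.inr hmem))

/-- A vertex on two edges that pass through no other vertices is a common endpoint. -/
theorem mem_common_ends {e f : DrawnEdge V} (he : e.AvoidsVertices Γ.pos)
    (hf : f.AvoidsVertices Γ.pos) {p : ℝ × ℝ} (hpe : p ∈ e.curve) (hpf : p ∈ f.curve) {v : V}
    (hv : Γ.pos v = p) : p ∈ Γ.pos '' (e.ends ∩ f.ends) := by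
  subst hv
  exact ⟨v, ⟨he v hpe, hf v hpf⟩, rfl⟩

variable (Λ) in
noncomputable abbrev monotoneDrawing : MonotoneDrawing V Λ.monotoneEdges :=
  (isMonotoneFamily (Λ := Λ) subset_rfl).drawing

/-- Monotone edges consist of points of the monotone drawing; the inner points of an inserted level
segment form a rung. -/
theorem not_free_of_mem {f : DrawnEdge V} (hf : f ∈ Λ.edges) {p : ℝ × ℝ} (hp : p ∈ f.curve) :
    ¬ Λ.monotoneDrawing.Free C p.1 p.2 := by
  intro hfree
  rcases monotone_or_segment hf with h | ⟨hadd, h1, h2, h3, h4⟩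
  · exact hfree.1 ((isMonotoneFamily subset_rfl).item_of_mem_curve h hp)
  have hlev : (Γ.pos f.tail).2 = (Γ.pos f.head).2 := by rw [Γ.pos_level, Γ.pos_level, h1]
  have hC := (Λ.maximal.1.1 f hadd).2
  obtain ⟨hp2, hp3, hp4⟩ := (mem_horizontal_segment_iff hlev h2).1 (h4 ▸ hp)
  have hnv : ∀ v, (Γ.pos v).2 = p.2 → (Γ.pos v).1 ≠ p.1 := fun v hv1 hv2 =>
    hfree.1 (Or.inl ⟨v, hv1, hv2⟩)
  refine hfree.2 ⟨f.tail, hC.1, f.head, hC.2, hp2.symm, hlev.symm.trans hp2.symm,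
    lt_of_le_of_ne hp3 (hnv _ hp2.symm), lt_of_le_of_ne hp4 (hnv _ (hlev.symm.trans hp2.symm)).symm,
    fun s hs hs' => ?_⟩
  rintro (⟨v, hv, rfl⟩ | ⟨i, hi, rfl⟩)
  · refine h3 v ?_ ⟨hs, hs'⟩
    rw [← Γ.pos_level, ← Γ.pos_level]
    exact hv.trans hp2
  · have hne : f ≠ i.1 := by
      intro he
      have := i.2.2.1
      rw [← he] at this
      exact this.ne hlev
    obtain ⟨v, ⟨hv, -⟩, hv'⟩ := nonCrossing hf i.2.1 hne
      (a := (Λ.monotoneDrawing.f i p.2, p.2))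
      ⟨by rw [h4, mem_horizontal_segment_iff hlev h2]; exact ⟨hp2, hs.le, hs'.le⟩,
        ((isMonotoneFamily subset_rfl).mem_curve_iff i _).2 ⟨hi, rfl⟩⟩
    have hv' : (Γ.pos v).1 = Λ.monotoneDrawing.f i p.2 := by rw [hv']
    rcases hv with rfl | rfl
    · exact hs.ne hv'
    · exact hs'.ne hv'.symm

theorem adj_of_reach {u w : V} (hu : u ∈ C) (hw : w ∈ C)
    (h : Λ.monotoneDrawing.Reach C (Γ.pos u).1 (Γ.pos u).2 (Γ.pos w).1 (Γ.pos w).2) :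
    (Λ.inducedGraph C).Adj ⟨u, hu⟩ ⟨w, hw⟩ := by
  obtain ⟨hlt, g, hg, hgu, hgw, hfree⟩ := h
  let e : DrawnEdge V := ⟨u, w, (fun y => (g y, y)) '' Set.Icc (Γ.pos u).2 (Γ.pos w).2⟩
  have hpt : ∀ p ∈ e.curve, p = Γ.pos u ∨ p = Γ.pos w ∨ Λ.monotoneDrawing.Free C p.1 p.2 := by
    rintro _ ⟨t, ht, rfl⟩
    rcases eq_or_lt_of_le ht.1 with h1 | h1
    · exact Or.inl (Prod.ext (by rw [← h1]; exact hgu) h1.symm)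
    rcases eq_or_lt_of_le ht.2 with h2 | h2
    · exact Or.inr (Or.inl (Prod.ext (by rw [h2]; exact hgw) h2))
    · exact Or.inr (Or.inr (hfree t h1 h2))
  have hav : e.AvoidsVertices Γ.pos := by
    intro v hv
    rcases hpt _ hv with h | h | h
    · exact Or.inl (Γ.pos_injective h)
    · exact Or.inr (Γ.pos_injective h)
    · exact absurd (Or.inl ⟨v, rfl, rfl⟩) h.1
  have hcr : ∀ f ∈ Λ.edges, e.NonCrossing Γ.pos f := by
    rintro f hf p ⟨hp, hpf⟩
    rcases hpt p hp with h | h | h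
    · exact mem_common_ends hav (avoids hf) hp hpf h.symm
    · exact mem_common_ends hav (avoids hf) hp hpf h.symm
    · exact absurd h (not_free_of_mem hf hpf)
  exact adj_of_visible (e := e) hu hw
    ⟨Or.inl ⟨hlt, g, hg.continuousOn, hgu, hgw, rfl⟩, hav, fun f hf => hcr f (Or.inl hf)⟩
    fun f hf _ => hcr f (Or.inr hf)

theorem adj_of_rung {u w : V} (hu : u ∈ C) (hw : w ∈ C) (hlev : (Γ.pos u).2 = (Γ.pos w).2)
    (hlt : (Γ.pos u).1 < (Γ.pos w).1)
    (hI : ∀ s, (Γ.pos u).1 < s → s < (Γ.pos w).1 → ¬ Λ.monotoneDrawing.Item s (Γ.pos u).2) :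
    (Λ.inducedGraph C).Adj ⟨u, hu⟩ ⟨w, hw⟩ := by
  let e : DrawnEdge V := ⟨u, w, segment ℝ (Γ.pos u) (Γ.pos w)⟩
  have hpt : ∀ p ∈ e.curve, p = Γ.pos u ∨ p = Γ.pos w ∨
      (p.2 = (Γ.pos u).2 ∧ (Γ.pos u).1 < p.1 ∧ p.1 < (Γ.pos w).1) := by
    intro p hp
    obtain ⟨h1, h2, h3⟩ := (mem_horizontal_segment_iff hlev hlt).1 hp
    rcases eq_or_lt_of_le h2 with h4 | h4
    · exact Or.inl (Prod.ext h4.symm h1)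
    rcases eq_or_lt_of_le h3 with h5 | h5
    · exact Or.inr (Or.inl (Prod.ext h5 (h1.trans hlev)))
    · exact Or.inr (Or.inr ⟨h1, h4, h5⟩)
  have hnv : ∀ v, (Γ.pos v).2 = (Γ.pos u).2 → (Γ.pos u).1 < (Γ.pos v).1 →
      ¬ (Γ.pos v).1 < (Γ.pos w).1 := fun v h h1 h2 => hI _ h1 h2 (Or.inl ⟨v, h, rfl⟩)
  have hav : e.AvoidsVertices Γ.pos := by
    intro v hv
    rcases hpt _ hv with h | h | ⟨h1, h2, h3⟩
    · exact Or.inl (Γ.pos_injective h)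
    · exact Or.inr (Γ.pos_injective h)
    · exact absurd h3 (hnv v h1 h2)
  have hseg : Γ.IsLevelSegment e := by
    refine ⟨?_, hlt, fun v hv h => hnv v ?_ h.1 h.2, rfl⟩
    · rw [← Γ.pos_level, ← Γ.pos_level]
      exact hlev
    · rw [Γ.pos_level, Γ.pos_level]
      exact hv
  have hcr : ∀ f ∈ Λ.edges, e ≠ f → e.NonCrossing Γ.pos f := by
    rintro f hf hne p ⟨hp, hpf⟩
    rcases hpt p hp with h | h | ⟨h1, h2, h3⟩
    · exact mem_common_ends hav (avoids hf) hp hpf h.symm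
    · exact mem_common_ends hav (avoids hf) hp hpf h.symm
    exfalso
    rcases monotone_or_segment hf with h | ⟨hadd, hs⟩
    · exact hI p.1 h2 h3 (h1 ▸ (isMonotoneFamily subset_rfl).item_of_mem_curve h hpf)
    -- Another level segment through an inner point of `e` also joins consecutive vertices, so it
    -- has the same left end and equals `e`.
    obtain ⟨f1, f2, f3, f4⟩ := id hs
    have flev : (Γ.pos f.tail).2 = (Γ.pos f.head).2 := by rw [Γ.pos_level, Γ.pos_level, f1]
    obtain ⟨g1, g2, g3⟩ := (mem_horizontal_segment_iff flev f2).1 (f4 ▸ hpf)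
    have htl : (Γ.pos f.tail).2 = (Γ.pos u).2 := g1.symm.trans h1
    have htail : (Γ.pos f.tail).1 ≤ (Γ.pos u).1 := by
      by_contra hcon
      exact hnv f.tail htl (not_le.1 hcon) (g2.trans_lt h3)
    have hul : 𝒢.level u = 𝒢.level f.tail := by rw [← Γ.pos_level, ← Γ.pos_level, htl]
    have htail' : (Γ.pos f.tail).1 = (Γ.pos u).1 := by
      by_contra hcon
      exact f3 u hul ⟨lt_of_le_of_ne htail hcon, h2.trans_le g3⟩
    exact hne (eq_of_segments hseg hs (Γ.pos_injective (Prod.ext htail' htl)).symm)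
  refine adj_of_visible (e := e) hu hw
    ⟨Or.inr hseg, hav, fun f hf => hcr f (Or.inl hf) fun he => ?_⟩
    fun f hf hne => hcr f (Or.inr hf) hne
  have := (mem_monotoneEdges_of_mem (Λ := Λ) hf).2.1
  rw [← he] at this
  exact this.ne hlev

variable (Λ) in
/-- The vertices of `C` in the connected component of `v`. -/
def component (v : V) : Set V :=
  {w | ∃ (hv : v ∈ C) (hw : w ∈ C), (Λ.inducedGraph C).Reachable ⟨v, hv⟩ ⟨w, hw⟩}

theorem component_eq {u w : V} {hu : u ∈ C} {hw : w ∈ C}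
    (h : (Λ.inducedGraph C).Adj ⟨u, hu⟩ ⟨w, hw⟩) : Λ.component u = Λ.component w := by
  ext v
  exact ⟨fun ⟨_, hv, hr⟩ => ⟨hw, hv, h.reachable.symm.trans hr⟩,
    fun ⟨_, hv, hr⟩ => ⟨hu, hv, h.reachable.trans hr⟩⟩

variable (Λ) in
noncomputable def coloredDrawing (hiso : ∀ v, ¬ 𝒢.undirected.IsIsolated v)
    (hcov : 𝒢.undirected.IsVertexCover C) : ColoredDrawing V Λ.monotoneEdges (Set V) where
  toMonotoneDrawing := Λ.monotoneDrawing
  C := C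
  col := Λ.component
  cover := by
    rintro ⟨e, he | he, -⟩
    · refine hcov ⟨?_, Or.inl he.1⟩
      exact ne_of_mem_edges (Λ := Λ) (Or.inl he)
    · exact Or.inl (Λ.maximal.1.1 e he).2.1
  covered v _ := by
    have h := hiso v
    unfold SimpleGraph.IsIsolated at h
    push Not at h
    obtain ⟨w, -, hw | hw⟩ := h
    · exact ⟨⟨⟨v, w, Γ.curve v w⟩, mem_monotoneEdges_of_mem ⟨hw, rfl⟩⟩, Or.inl rfl⟩
    · exact ⟨⟨⟨w, v, Γ.curve w v⟩, mem_monotoneEdges_of_mem ⟨hw, rfl⟩⟩, Or.inr rfl⟩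
  col_edge i ht hh := component_eq (adj_of_mem i.2.1 ht hh)
  col_reach _ hu _ hw h := component_eq (adj_of_reach hu hw h)
  col_rung _ hu _ hw h1 h2 h3 := component_eq (adj_of_rung hu hw h1 h2 h3)

theorem connected_inducedGraph [Finite V] [Nonempty V] (hiso : ∀ v, ¬ 𝒢.undirected.IsIsolated v)
    (hcov : 𝒢.undirected.IsVertexCover C) : (Λ.inducedGraph C).Connected := by
  have hne : Nonempty C := by
    obtain ⟨v⟩ := ‹Nonempty V›
    have h := hiso v
    unfold SimpleGraph.IsIsolated at h
    push Not at h
    obtain ⟨w, hw⟩ := h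
    rcases hcov hw with h | h
    · exact ⟨⟨v, h⟩⟩
    · exact ⟨⟨w, h⟩⟩
  have := (Λ.finite_monotoneEdges).to_subtype
  refine (SimpleGraph.connected_iff _).2 ⟨fun u w => ?_, hne⟩
  have h : Λ.component u.1 = Λ.component w.1 := (Λ.coloredDrawing hiso hcov).col_eq u.2 w.2
  have hw : w.1 ∈ Λ.component w.1 := ⟨w.2, w.2, SimpleGraph.Reachable.refl _⟩
  rw [← h] at hw
  exact hw.2.2

end Connectivity

end VisibilityExtension

end LevelPlanarity

theorem mainTheorem7 :
    ∃ c : ℕ, ∀ (V : Type*) [Finite V] (𝒢 : LevelPlanarity.LevelGraph V) (C : Set V),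
      (∀ v, ¬ 𝒢.undirected.IsIsolated v) → 𝒢.undirected.IsVertexCover C →
      ∀ (Γ : LevelPlanarity.LevelPlanarDrawing 𝒢) (Λ : LevelPlanarity.VisibilityExtension Γ C),
        (Nonempty V → (Λ.inducedGraph C).Connected) ∧
        (Λ.inducedEdges C).Finite ∧ (Λ.inducedEdges C).ncard ≤ c * C.ncard := by
  refine ⟨4, fun V _ 𝒢 C hiso hcov Γ Λ => ⟨fun _ => ?_, ?_⟩⟩
  · exact LevelPlanarity.VisibilityExtension.connected_inducedGraph hiso hcov
  · exact LevelPlanarity.VisibilityExtension.finite_inducedEdges
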